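/- Let $(M,\mathcal T)$ be a connected closed triangulated surface: the quotient of a finite disjoint union of triangles obtained by identifying all their sides in pairs by homeomorphisms, with sets $V,E,F$ of vertices, unoriented edges and triangles. Let $\varepsilon:V\to\{0,1\}$ and $\eta:E\to\mathbb R$ be weights satisfying the structure conditions $$\varepsilon_s\varepsilon_t+\eta_{st}>0\quad\text{for every edge }\{st\}\in E,\qquad \varepsilon_q\eta_{st}+\eta_{qs}\eta_{qt}\ge 0\quad\text{for }\{q,s,t\}=\{i,j,k\},\ \{ijk\}\in F.$$ For $f:V\to\mathbb R$ (a generalized hyperbolic discrete conformal factor) define $l_{ij}\ge 0$ on the edge $\{ij\}$ by $$\cosh l_{ij}=\sqrt{(1+\varepsilon_ie^{2f_i})(1+\varepsilon_je^{2f_j})}+\eta_{ij}e^{f_i+f_j},$$ and put $u_i=f_i$ if $\varepsilon_i=0$ and $u_i=\frac12\log\left|\frac{\sqrt{1+\varepsilon_ie^{2f_i}}-1}{\sqrt{1+\varepsilon_ie^{2f_i}}+1}\right|$ if $\varepsilon_i=1$, so that $f\mapsto u$ is a bijection from $\mathbb R^V$ onto the set of $u\in\mathbb R^V$ with $u_i<0$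 whenever $\varepsilon_i=1$; such $u$ are also called generalized hyperbolic discrete conformal factors. The factor is nondegenerate if in every triangle the three edge lengths are positive and satisfy the strict triangle inequalities. For a triangle with these properties let $\theta_i$ be the inner angle at its corner $i$ in the hyperbolic triangle with edge lengths $l$, and set $\widetilde\theta_i=\theta_i$; on a degenerate triangle $\{ijk\}$ set $\widetilde\theta_i=\pi$ if $l_{jk}\ge l_{ij}+l_{ik}$, and $\widetilde\theta_i=0$ otherwise. The combinatorial curvature of a nondegenerate factor is $K_i=2\pi-\sum\theta_i$, and the generalized combinatorial curvature of any generalized factor is $\widetilde K_i=2\pi-\sum\widetilde\theta_i$, the sums running over the corners of triangles at $i$. Let $\overline K:V\to(-\infty,2\pi)$ satisfy $\sum_{i\in V}\overline K_i>2\pi\chi(M)$, and consider the extended modified hyperbolic combinatorial Ricci flow $$\frac{du_i}{dt}=\overline K_i-\widetilde K_i,\qquad i\in V.$$ 1. For every initial generalized hyperbolic discrete conformal factor $u(0)$ the solution exists for all time: there is a solution on $[0,\infty)$ with this initial value, and every solution on an interval $[0,\tau)$ with this initial value is a restriction of it. 2. Along every solution on $[0,\infty)$, $u_i$ stays bounded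 away from $0$ at each vertex $i$ with $\varepsilon_i=1$: there is $c<0$ with $u_i(t)\le c$ for all $t\ge0$. 3. If there is a nondegenerate hyperbolic discrete conformal factor $\overline u$ with combinatorial curvature $\overline K$, then for every initial generalized hyperbolic discrete conformal factor the solution converges exponentially fast to $\overline u$: there are constants $A$ and $a>0$ (which may depend on the solution) with $|u_i(t)-\overline u_i|\le Ae^{-at}$ for all $t\ge0$ and $i\in V$. -/

import Mathlib

namespace DiscreteConformal

/-- A finite disjoint union of triangles, indexed by `F`, whose sides are identified in pairs.
The corners of the triangle `σ` are `(σ, 0)`, `(σ, 1)`, `(σ, 2)`, and the side `(σ, k)` is the one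
opposite to the corner `(σ, k)`; it runs from the corner `(σ, k + 1)` to the corner `(σ, k + 2)`.
The side `s` is identified with the side `mate s ≠ s`, by a homeomorphism that preserves the above
directions if `flip s = false` and that reverses them if `flip s = true`.
The quotient space is a closed surface triangulated by `F`. -/
structure Triangulation (F : Type*) where
  mate : F × Fin 3 → F × Fin 3
  mate_mate : ∀ s, mate (mate s) = s
  mate_ne : ∀ s, mate s ≠ s
  flip : F × Fin 3 → Bool
  flip_mate : ∀ s, flip (mate s) = flip s

namespace Triangulation

variable {F : Type*} (T : Triangulation F)

/-- The initial (`b = false`) or terminal (`b = true`) corner of a side. -/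
def sideEnd (s : F × Fin 3) (b : Bool) : F × Fin 3 :=
  (s.1, s.2 + if b then 2 else 1)

/-- Two corners are directly glued if they are matching ends of two identified sides. -/
def CornerGlued (x y : F × Fin 3) : Prop :=
  ∃ s b, x = sideEnd s b ∧ y = sideEnd (T.mate s) (xor b (T.flip s))

/-- The set `V` of vertices: corners modulo the equivalence relation generated by the gluing. -/
def Vertex : Type _ := Quot T.CornerGlued

/-- The set `E` of unoriented edges: sides modulo the gluing. -/
def Edge : Type _ := Quot fun s t : F × Fin 3 => t = T.mate s

/-- The vertex at a corner. -/
def vertex (x : F × Fin 3) : T.Vertex := Quot.mk _ x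

/-- The edge on which a side lies. -/
def edge (s : F × Fin 3) : T.Edge := Quot.mk _ s

instance [Finite F] : Finite T.Vertex := inferInstanceAs (Finite (Quot _))

instance [Finite F] : Finite T.Edge := inferInstanceAs (Finite (Quot _))

noncomputable instance [Finite F] : Fintype T.Vertex := Fintype.ofFinite _

/-- The surface is connected (in particular nonempty): any two triangles are joined by a chain of
triangles in which consecutive ones have a common edge. -/
def Connected : Prop :=
  Nonempty F ∧ ∀ σ τ : F,
    Relation.ReflTransGen (fun α β : F => ∃ k l : Fin 3, T.mate (α, k) = (β, l)) σ τ

/-- The Euler characteristic `|V| - |E| + |F|`. -/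
noncomputable def eulerChar : ℤ :=
  (Nat.card T.Vertex : ℤ) - (Nat.card T.Edge : ℤ) + (Nat.card F : ℤ)

theorem vertex_sideEnd_mate (s : F × Fin 3) (b : Bool) :
    T.vertex (sideEnd (T.mate s) (xor b (T.flip s))) = T.vertex (sideEnd s b) :=
  (Quot.sound ⟨s, b, rfl, rfl⟩).symm

theorem edge_mate (s : F × Fin 3) : T.edge (T.mate s) = T.edge s :=
  (Quot.sound (r := fun s t : F × Fin 3 => t = T.mate s) rfl).symm

/-- First structure condition: `ε_s ε_t + η_st > 0` for every edge `{st}`. -/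
def StructureCondition₁ (ε : T.Vertex → ℝ) (η : T.Edge → ℝ) : Prop :=
  ∀ s : F × Fin 3,
    0 < ε (T.vertex (sideEnd s false)) * ε (T.vertex (sideEnd s true)) + η (T.edge s)

/-- Second structure condition: `ε_q η_st + η_qs η_qt ≥ 0` for every corner `q` of every
triangle `{qst}`. -/
def StructureCondition₂ (ε : T.Vertex → ℝ) (η : T.Edge → ℝ) : Prop :=
  ∀ (σ : F) (q : Fin 3),
    0 ≤ ε (T.vertex (σ, q)) * η (T.edge (σ, q)) + η (T.edge (σ, q + 1)) * η (T.edge (σ, q + 2))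

/-- `cosh l_ij = √((1 + ε_i e^{2 f_i}) (1 + ε_j e^{2 f_j})) + η_ij e^{f_i + f_j}`. -/
noncomputable def coshLength (εi εj ηij fi fj : ℝ) : ℝ :=
  √((1 + εi * Real.exp (2 * fi)) * (1 + εj * Real.exp (2 * fj))) + ηij * Real.exp (fi + fj)

theorem coshLength_comm (a b h x y : ℝ) : coshLength a b h x y = coshLength b a h y x := by
  unfold coshLength
  rw [mul_comm (1 + a * _), add_comm x y]

/-- The hyperbolic length of a side. -/
noncomputable def sideLength (ε : T.Vertex → ℝ) (η : T.Edge → ℝ) (f : T.Vertex → ℝ)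
    (s : F × Fin 3) : ℝ :=
  let i := T.vertex (sideEnd s false)
  let j := T.vertex (sideEnd s true)
  Real.arcosh (coshLength (ε i) (ε j) (η (T.edge s)) (f i) (f j))

theorem sideLength_mate (ε : T.Vertex → ℝ) (η : T.Edge → ℝ) (f : T.Vertex → ℝ)
    (s : F × Fin 3) : T.sideLength ε η f (T.mate s) = T.sideLength ε η f s := by
  have h := T.vertex_sideEnd_mate s
  have h0 := h false
  have h1 := h true
  unfold sideLength
  cases hb : T.flip s
  · simp only [hb, Bool.xor_false] at h0 h1
    simp only [h0, h1, edge_mate]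
  · simp only [hb, Bool.xor_true, Bool.not_false, Bool.not_true] at h0 h1
    simp only [h0, h1, edge_mate]
    rw [coshLength_comm]

/-- The edge length function `l : E → ℝ` of the function `f : V → ℝ` in the hyperbolic background
geometry. -/
noncomputable def edgeLength (ε : T.Vertex → ℝ) (η : T.Edge → ℝ) (f : T.Vertex → ℝ) :
    T.Edge → ℝ :=
  Quot.lift (T.sideLength ε η f) (by rintro s _ rfl; exact (T.sideLength_mate ε η f s).symm)

/-- `f` is nondegenerate on the triangle `σ`: the three edge lengths are positive and satisfy the
strict triangle inequalities. -/
def FaceNondegenerate (ε : T.Vertex → ℝ) (η : T.Edge → ℝ) (f : T.Vertex → ℝ) (σ : F) : Prop :=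
  let l : Fin 3 → ℝ := fun k => T.edgeLength ε η f (T.edge (σ, k))
  (∀ k, 0 < l k) ∧ ∀ k, l k < l (k + 1) + l (k + 2)

/-- `f` is a (nondegenerate) hyperbolic discrete conformal factor. -/
def Nondegenerate (ε : T.Vertex → ℝ) (η : T.Edge → ℝ) (f : T.Vertex → ℝ) : Prop :=
  ∀ σ, T.FaceNondegenerate ε η f σ

/-- The inner angle at the corner `(σ, k)`, by the hyperbolic cosine law. -/
noncomputable def angle (ε : T.Vertex → ℝ) (η : T.Edge → ℝ) (f : T.Vertex → ℝ)
    (x : F × Fin 3) : ℝ :=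
  let l : Fin 3 → ℝ := fun m => T.edgeLength ε η f (T.edge (x.1, m))
  let k := x.2
  Real.arccos ((Real.cosh (l (k + 1)) * Real.cosh (l (k + 2)) - Real.cosh (l k)) /
    (Real.sinh (l (k + 1)) * Real.sinh (l (k + 2))))

open Classical in
/-- The extension of the inner angle at the corner `(σ, k)` by constants: on a degenerate triangle
it is `π` if the side opposite to the corner is at least as long as the two other sides together,
and `0` otherwise. -/
noncomputable def extAngle (ε : T.Vertex → ℝ) (η : T.Edge → ℝ) (f : T.Vertex → ℝ)
    (x : F × Fin 3) : ℝ :=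
  let l : Fin 3 → ℝ := fun m => T.edgeLength ε η f (T.edge (x.1, m))
  let k := x.2
  if T.FaceNondegenerate ε η f x.1 then T.angle ε η f x
  else if l (k + 1) + l (k + 2) ≤ l k then Real.pi
  else 0

open Classical in
/-- The combinatorial curvature `K_i`: `2π` less the sum of the inner angles at the vertex `i`. -/
noncomputable def curvature [Fintype F] (ε : T.Vertex → ℝ) (η : T.Edge → ℝ) (f : T.Vertex → ℝ)
    (i : T.Vertex) : ℝ :=
  2 * Real.pi - ∑ x : F × Fin 3, if T.vertex x = i then T.angle ε η f x else 0

open Classical in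
/-- The generalized combinatorial curvature, defined with the extended inner angles. -/
noncomputable def extCurvature [Fintype F] (ε : T.Vertex → ℝ) (η : T.Edge → ℝ) (f : T.Vertex → ℝ)
    (i : T.Vertex) : ℝ :=
  2 * Real.pi - ∑ x : F × Fin 3, if T.vertex x = i then T.extAngle ε η f x else 0

/-- The coordinate `u_i` as a function of `ε_i` and `f_i`. For `ε_i = 0` it is a bijection from `ℝ`
to `ℝ`, and for `ε_i = 1` a bijection from `ℝ` to `(-∞, 0)`. -/
noncomputable def uCoord (εi fi : ℝ) : ℝ :=
  if εi = 0 then fi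
  else 1 / 2 * Real.log |(√(1 + εi * Real.exp (2 * fi)) - 1) / (√(1 + εi * Real.exp (2 * fi)) + 1)|

/-- The curve `t ↦ f t` of generalized hyperbolic discrete conformal factors solves the extended
modified hyperbolic combinatorial Ricci flow `du_i/dt = Kbar_i - K_i` on the time interval `I`,
where `u_i` is the coordinate of `f_i` and `K` is the generalized combinatorial curvature. -/
def IsSolutionOn [Fintype F] (ε : T.Vertex → ℝ) (η : T.Edge → ℝ) (Kbar : T.Vertex → ℝ)
    (I : Set ℝ) (f : ℝ → T.Vertex → ℝ) : Prop :=
  ∀ t ∈ I, ∀ i : T.Vertex,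
    HasDerivWithinAt (fun s => uCoord (ε i) (f s i)) (Kbar i - T.extCurvature ε η (f t) i) I t

end Triangulation

end DiscreteConformal

/-! In the coordinates `u` the extended curvature is a monotone map: the sum over `i` of `(u i - v
i) * (K i u - K i v)` is nonnegative on the convex set of admissible `u`. Hence the flow does not
increase Euclidean distances. The theorem rests on this monotonicity and on a barrier at `u i = 0`.

Monotonicity is proved triangle by triangle. On a nondegenerate triangle the derivative of the
angles is a negative multiple of `angleMatrix`, whose quadratic form is a sum of three definite
binary forms, weighted by the signed distances of the orthogonal centre from the sides. If no weight
is negative, the matrix is positive semidefinite, and it is nonsingular by `det_angleMatrix` and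
`lengthDet_pos`. If a weight is negative, the structure conditions (`pos_of_centerCoord_neg`) permit
a deformation from a matrix in which this weight is zero, without the determinant vanishing
(`angleMatrix_posDef_of_pos`). On a degenerate triangle every extended angle is `0` or `π`. So along
a segment the weighted angle sum is continuous and, at each time, either has nonpositive derivative
or takes one of finitely many values; this makes it nonincreasing
(`le_of_deriv_nonpos_or_mem_finite`).

For the barrier, the angles at a vertex of weight one tend to `0` as its coordinate tends to `0`,
uniformly in the other coordinates (`IsStructure.eventually_triAngle_le`). The curvature there
approaches `2π`, which exceeds the target, and the flow pushes the coordinate down.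

The velocity field is treated as merely continuous. Smooth approximations have solutions that form
Cauchy sequences by monotonicity (`exists_solution_of_dissipative`), and uniqueness follows from the
same estimate. If the target curvature is attained at a nondegenerate factor, the derivative there
is positive definite; monotonicity along rays spreads this to a quadratic lower bound on every ball
(`exists_coercive`), and the squared distance to the factor decays exponentially. -/

namespace DiscreteConformal

/-- A positive definite matrix stays positive definite along a segment on which the determinant
does not vanish. -/
theorem posDef_add_of_det_ne_zero {n : Type*} [Fintype n] [DecidableEq n] {A B : Matrix n n ℝ}
    (hA : A.PosDef) (hB : B.IsHermitian)
    (hdet : ∀ t ∈ Set.Icc (0 : ℝ) 1, (A + t • B).det ≠ 0) : (A + B).PosDef := by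
  have hAB : ∀ t : ℝ, (A + t • B).IsHermitian := fun t =>
    hA.1.add (hB.smul (IsSelfAdjoint.all t))
  have hAx : ∀ x : n → ℝ, x ≠ 0 → 0 < x ⬝ᵥ (A.mulVec x) := fun x hx => by
    simpa using hA.dotProduct_mulVec_pos hx
  by_contra hcon
  have hex : ∃ x : n → ℝ, x ≠ 0 ∧ x ⬝ᵥ (A + B).mulVec x ≤ 0 := by
    by_contra h
    push Not at h
    refine hcon (Matrix.PosDef.of_dotProduct_mulVec_pos (by simpa using hAB 1) fun x hx => ?_)
    simpa using h x hx
  obtain ⟨x₀, hx₀, hle⟩ := hex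
  set R : (n → ℝ) → ℝ := fun x => (x ⬝ᵥ B.mulVec x) / (x ⬝ᵥ A.mulVec x) with hR
  have hcont : ContinuousOn R (Metric.sphere 0 1) := by
    refine ContinuousOn.div (by fun_prop) (by fun_prop) fun x hx => (hAx x ?_).ne'
    rintro rfl
    simp at hx
  have hne : (Metric.sphere (0 : n → ℝ) 1).Nonempty :=
    ⟨‖x₀‖⁻¹ • x₀, by simp [norm_smul, hx₀]⟩
  obtain ⟨y, hy, hmin⟩ := (isCompact_sphere (0 : n → ℝ) 1).exists_isMinOn hne hcont
  have hy0 : y ≠ 0 := by rintro rfl; simp at hy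
  have hscale : ∀ x : n → ℝ, x ≠ 0 → R y ≤ R x := fun x hx => by
    have h := hmin (show ‖x‖⁻¹ • x ∈ Metric.sphere (0 : n → ℝ) 1 by simp [norm_smul, hx])
    have h' : R (‖x‖⁻¹ • x) = R x := by
      have hx' : ‖x‖⁻¹ ≠ 0 := by simpa using hx
      simp only [hR, Matrix.mulVec_smul, dotProduct_smul, smul_dotProduct, smul_eq_mul]
      rw [mul_div_mul_left _ _ hx', mul_div_mul_left _ _ hx']
    simpa [h'] using h
  have hm : R y ≤ -1 := by
    refine (hscale x₀ hx₀).trans ?_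
    rw [hR]
    simp only
    rw [div_le_iff₀ (hAx x₀ hx₀)]
    rw [Matrix.add_mulVec, dotProduct_add] at hle
    linarith
  -- The form of `A + t • B` is `1 + t * R` times that of `A`. For this `t` it is nonnegative, since
  -- `y` minimizes `R`, but it vanishes at `y`, so that `A + t • B` is singular.
  set t : ℝ := -(R y)⁻¹ with ht
  have hneg : R y < 0 := by linarith
  have htR : t * R y = -1 := by rw [ht, neg_mul, inv_mul_cancel₀ hneg.ne]
  have ht0 : 0 < t := by rw [ht, neg_pos]; exact inv_lt_zero.2 hneg
  have ht1 : t ≤ 1 := by nlinarith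
  have hform : ∀ x : n → ℝ, x ≠ 0 →
      x ⬝ᵥ (A + t • B).mulVec x = (1 + t * R x) * (x ⬝ᵥ A.mulVec x) := fun x hx => by
    have := (hAx x hx).ne'
    rw [Matrix.add_mulVec, dotProduct_add, Matrix.smul_mulVec, dotProduct_smul, hR]
    simp only [smul_eq_mul]
    field_simp
  have hpsd : (A + t • B).PosSemidef := by
    refine Matrix.PosSemidef.of_dotProduct_mulVec_nonneg (hAB t) fun x => ?_
    by_cases hx : x = 0
    · simp [hx]
    · simp only [star_trivial]
      rw [hform x hx]
      have := hscale x hx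
      exact mul_nonneg (by nlinarith) (hAx x hx).le
  have hpd : (A + t • B).PosDef :=
    hpsd.posDef_iff_det_ne_zero.2 (hdet t ⟨ht0.le, ht1⟩)
  have h0 : 0 < y ⬝ᵥ (A + t • B).mulVec y := by simpa using hpd.dotProduct_mulVec_pos hy0
  rw [hform y hy0, htR] at h0
  simp at h0

/-! ### Positive definiteness of the angle matrix of a hyperbolic triangle -/

section Triangle

/-- The determinant of the Gram matrix of the vertices of a hyperbolic triangle, in terms of the
hyperbolic cosines of its sides. -/
def gramDet (x y z : ℝ) : ℝ := 1 + 2 * x * y * z - x ^ 2 - y ^ 2 - z ^ 2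

/-- Up to a positive factor, the signed distance of the orthogonal centre of a triangle from the
side with hyperbolic cosine `z`. -/
def centerCoord (x y z a b c : ℝ) : ℝ :=
  a * (z * x - y) + b * (z * y - x) - c * (z ^ 2 - 1)

/-- The matrix of the derivative of the angles, up to a negative factor. -/
noncomputable def angleMatrix (x y z a b c : ℝ) : Matrix (Fin 3) (Fin 3) ℝ :=
  let p := centerCoord y z x b c a / (x ^ 2 - 1)
  let q := centerCoord z x y c a b / (y ^ 2 - 1)
  let r := centerCoord x y z a b c / (z ^ 2 - 1)
  !![q * y + r * z, -r, -q; -r, p * x + r * z, -p; -q, -p, p * x + q * y]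

/-- The determinant of the derivative of the edge lengths, up to a positive factor. -/
def lengthDet (x y z a b c : ℝ) : ℝ :=
  (a * z - b) * (b * x - c) * (c * y - a) + (b * z - a) * (c * x - b) * (a * y - c)

variable {x y z a b c : ℝ}

theorem angleMatrix_isHermitian : (angleMatrix x y z a b c).IsHermitian := by
  ext i j
  fin_cases i <;> fin_cases j <;> simp [angleMatrix, Matrix.conjTranspose]

/-- The angles depend on `u` through the lengths, so their Jacobian is a product. The derivative of
the angles in the lengths contributes a power of the Gram determinant, and that of the lengths in
`u` contributes `lengthDet`. -/
theorem det_angleMatrix (hx : 1 < x) (hy : 1 < y) (hz : 1 < z) :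
    (angleMatrix x y z a b c).det * ((x ^ 2 - 1) * (y ^ 2 - 1) * (z ^ 2 - 1)) =
      gramDet x y z ^ 2 * lengthDet x y z a b c := by
  have h1 : x ^ 2 - 1 ≠ 0 := by nlinarith
  have h2 : y ^ 2 - 1 ≠ 0 := by nlinarith
  have h3 : z ^ 2 - 1 ≠ 0 := by nlinarith
  rw [Matrix.det_fin_three]
  simp only [angleMatrix, centerCoord, gramDet, lengthDet, Matrix.of_apply, Matrix.cons_val',
    Matrix.cons_val_zero, Matrix.cons_val_one, Matrix.cons_val]
  field_simp
  ring

/-- Each binary form is positive definite because the cosh of its side exceeds one, so only the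
signs of the three weights can spoil positivity. -/
theorem angleMatrix_form (w : Fin 3 → ℝ) :
    w ⬝ᵥ (angleMatrix x y z a b c).mulVec w =
      centerCoord y z x b c a / (x ^ 2 - 1) * (x * (w 1 ^ 2 + w 2 ^ 2) - 2 * w 1 * w 2) +
      centerCoord z x y c a b / (y ^ 2 - 1) * (y * (w 2 ^ 2 + w 0 ^ 2) - 2 * w 2 * w 0) +
      centerCoord x y z a b c / (z ^ 2 - 1) * (z * (w 0 ^ 2 + w 1 ^ 2) - 2 * w 0 * w 1) := by
  simp only [angleMatrix, dotProduct, Matrix.mulVec, Fin.sum_univ_three, Matrix.of_apply,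
    Matrix.cons_val', Matrix.cons_val_zero, Matrix.cons_val_one, Matrix.cons_val]
  ring

theorem mul_add_sq_sub_nonneg (hx : 1 < x) (s t : ℝ) :
    0 ≤ x * (s ^ 2 + t ^ 2) - 2 * s * t := by nlinarith [sq_nonneg (s - t), sq_nonneg s, sq_nonneg t]

theorem mul_add_sq_sub_pos (hx : 1 < x) {s t : ℝ} (h : s ≠ 0 ∨ t ≠ 0) :
    0 < x * (s ^ 2 + t ^ 2) - 2 * s * t := by
  have : 0 < s ^ 2 + t ^ 2 := by
    rcases h with h | h
    · have := sq_nonneg t; positivity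
    · have := sq_nonneg s; positivity
  nlinarith [sq_nonneg (s - t), mul_pos (sub_pos.2 hx) this]

theorem angleMatrix_posDef_of_nonneg (hx : 1 < x) (hy : 1 < y) (hz : 1 < z)
    (hg : 0 < gramDet x y z) (hd : 0 < lengthDet x y z a b c)
    (h1 : 0 ≤ centerCoord y z x b c a) (h2 : 0 ≤ centerCoord z x y c a b)
    (h3 : 0 ≤ centerCoord x y z a b c) : (angleMatrix x y z a b c).PosDef := by
  have k1 : 0 < x ^ 2 - 1 := by nlinarith
  have k2 : 0 < y ^ 2 - 1 := by nlinarith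
  have k3 : 0 < z ^ 2 - 1 := by nlinarith
  have hpsd : (angleMatrix x y z a b c).PosSemidef := by
    refine Matrix.PosSemidef.of_dotProduct_mulVec_nonneg angleMatrix_isHermitian fun w => ?_
    simp only [star_trivial]
    rw [angleMatrix_form]
    have := mul_add_sq_sub_nonneg hx (w 1) (w 2)
    have := mul_add_sq_sub_nonneg hy (w 2) (w 0)
    have := mul_add_sq_sub_nonneg hz (w 0) (w 1)
    positivity
  refine hpsd.posDef_iff_det_ne_zero.2 fun h0 => ?_
  have := det_angleMatrix (a := a) (b := b) (c := c) hx hy hz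
  rw [h0, zero_mul] at this
  exact (by positivity : gramDet x y z ^ 2 * lengthDet x y z a b c ≠ 0) this.symm

/-- The matrix is affine in `c`. It is positive definite at the value `c'` where the weight of side
`z` vanishes, and it stays so up to `c` because `lengthDet` is a concave quadratic in `c`, positive
at both ends. -/
theorem angleMatrix_posDef_of_pos (hx : 1 < x) (hy : 1 < y) (hz : 1 < z)
    (hg : 0 < gramDet x y z) (hd : 0 < lengthDet x y z a b c)
    (hab : 0 < a * z - b) (hba : 0 < b * z - a) :
    (angleMatrix x y z a b c).PosDef := by
  have k1 : 0 < x ^ 2 - 1 := by nlinarith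
  have k2 : 0 < y ^ 2 - 1 := by nlinarith
  have k3 : 0 < z ^ 2 - 1 := by nlinarith
  -- The zero of `centerCoord x y z a b` in its last argument: the orthogonal centre is moved onto
  -- side `z`. The other two weights become positive multiples of `b * z - a` and `a * z - b`.
  set c' : ℝ := (a * (z * x - y) + b * (z * y - x)) / (z ^ 2 - 1) with hc'
  have hc : c' * (z ^ 2 - 1) = a * (z * x - y) + b * (z * y - x) := by rw [hc']; field_simp
  clear_value c'
  have e3 : centerCoord x y z a b c' = 0 := by unfold centerCoord; linarith
  have e1 : centerCoord y z x b c' a * (z ^ 2 - 1) = gramDet x y z * (b * z - a) := by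
    unfold centerCoord gramDet
    linear_combination (x * z - y) * hc
  have e2 : centerCoord z x y c' a b * (z ^ 2 - 1) = gramDet x y z * (a * z - b) := by
    unfold centerCoord gramDet
    linear_combination (y * z - x) * hc
  have p1 : 0 < centerCoord y z x b c' a := by
    refine pos_of_mul_pos_left (b := z ^ 2 - 1) ?_ k3.le
    rw [e1]; positivity
  have p2 : 0 < centerCoord z x y c' a b := by
    refine pos_of_mul_pos_left (b := z ^ 2 - 1) ?_ k3.le
    rw [e2]; positivity
  have hpd : (angleMatrix x y z a b c').PosDef := by
    refine Matrix.PosDef.of_dotProduct_mulVec_pos angleMatrix_isHermitian fun w hw => ?_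
    simp only [star_trivial]
    rw [angleMatrix_form, e3, zero_div, zero_mul, add_zero]
    by_cases h : w 1 ≠ 0 ∨ w 2 ≠ 0
    · have := mul_add_sq_sub_pos hx h
      have := mul_add_sq_sub_nonneg hy (w 2) (w 0)
      positivity
    · have h0 : w 0 ≠ 0 := by
        push Not at h
        contrapose! hw
        ext i
        fin_cases i <;> simp [hw, h]
      have := mul_add_sq_sub_nonneg hx (w 1) (w 2)
      have := mul_add_sq_sub_pos hy (s := w 2) (t := w 0) (Or.inr h0)
      positivity
  have hline : ∀ t : ℝ, angleMatrix x y z a b c' +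
      t • (angleMatrix x y z a b c - angleMatrix x y z a b c') =
        angleMatrix x y z a b (c' + t * (c - c')) := fun t => by
    ext i j
    fin_cases i <;> fin_cases j <;> simp [angleMatrix, centerCoord] <;> field_simp <;> ring
  have hd' : 0 < lengthDet x y z a b c' := by
    have h := det_angleMatrix (a := a) (b := b) (c := c') hx hy hz
    refine pos_of_mul_pos_right (a := gramDet x y z ^ 2) ?_ (by positivity)
    rw [← h]
    have := hpd.det_pos
    positivity
  have := posDef_add_of_det_ne_zero hpd
    (B := angleMatrix x y z a b c - angleMatrix x y z a b c')
    (angleMatrix_isHermitian.sub angleMatrix_isHermitian) fun t ht h0 => by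
      rw [hline] at h0
      have h := det_angleMatrix (a := a) (b := b) (c := c' + t * (c - c')) hx hy hz
      rw [h0, zero_mul] at h
      -- Concavity made explicit: the last summand is the excess over linear interpolation,
      -- nonnegative by `hab` and `hba`.
      have hconc : lengthDet x y z a b (c' + t * (c - c')) =
          (1 - t) * lengthDet x y z a b c' + t * lengthDet x y z a b c +
          t * (1 - t) * (c - c') ^ 2 * ((a * z - b) * y + (b * z - a) * x) := by
        unfold lengthDet; ring
      have ht0 := ht.1
      have ht1 := sub_nonneg.2 ht.2
      have : 0 < (1 - t) * lengthDet x y z a b c' + t * lengthDet x y z a b c := by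
        rcases ht0.eq_or_lt with h | h
        · rw [← h]; simpa using hd'
        · positivity
      have : 0 < lengthDet x y z a b (c' + t * (c - c')) := by rw [hconc]; positivity
      exact (by positivity : gramDet x y z ^ 2 * lengthDet x y z a b (c' + t * (c - c')) ≠ 0)
        h.symm
  simpa using this

theorem gramDet_rotate : gramDet y z x = gramDet x y z := by unfold gramDet; ring

theorem lengthDet_rotate : lengthDet y z x b c a = lengthDet x y z a b c := by
  unfold lengthDet; ring

/-- The three cases of a negative weight differ by a rotation of the triangle, which permutes the
coordinates of `w` but not the value of the form. -/
theorem angleMatrix_form_pos (hx : 1 < x) (hy : 1 < y) (hz : 1 < z)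
    (hg : 0 < gramDet x y z) (hd : 0 < lengthDet x y z a b c)
    (h1 : centerCoord y z x b c a < 0 → 0 < b * x - c ∧ 0 < c * x - b)
    (h2 : centerCoord z x y c a b < 0 → 0 < c * y - a ∧ 0 < a * y - c)
    (h3 : centerCoord x y z a b c < 0 → 0 < a * z - b ∧ 0 < b * z - a)
    {w : Fin 3 → ℝ} (hw : w ≠ 0) : 0 < w ⬝ᵥ (angleMatrix x y z a b c).mulVec w := by
  by_cases k1 : centerCoord y z x b c a < 0
  · have h := angleMatrix_posDef_of_pos hy hz hx (by rwa [gramDet_rotate])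
      (by rwa [lengthDet_rotate]) (h1 k1).1 (h1 k1).2
    have := h.dotProduct_mulVec_pos (x := ![w 1, w 2, w 0]) (by
      contrapose! hw
      have h0 := congrFun hw 0
      have h1 := congrFun hw 1
      have h2 := congrFun hw 2
      ext i
      fin_cases i <;> simp_all)
    simp only [star_trivial] at this
    rw [angleMatrix_form] at this ⊢
    simp only [Matrix.cons_val_zero, Matrix.cons_val_one, Matrix.cons_val] at this
    linarith
  by_cases k2 : centerCoord z x y c a b < 0
  · have h := angleMatrix_posDef_of_pos hz hx hy (by rwa [← gramDet_rotate])
      (by rwa [← lengthDet_rotate]) (h2 k2).1 (h2 k2).2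
    have := h.dotProduct_mulVec_pos (x := ![w 2, w 0, w 1]) (by
      contrapose! hw
      have h0 := congrFun hw 0
      have h1 := congrFun hw 1
      have h2 := congrFun hw 2
      ext i
      fin_cases i <;> simp_all)
    simp only [star_trivial] at this
    rw [angleMatrix_form] at this ⊢
    simp only [Matrix.cons_val_zero, Matrix.cons_val_one, Matrix.cons_val] at this
    linarith
  by_cases k3 : centerCoord x y z a b c < 0
  · simpa using (angleMatrix_posDef_of_pos hx hy hz hg hd (h3 k3).1
      (h3 k3).2).dotProduct_mulVec_pos hw
  · simpa using (angleMatrix_posDef_of_nonneg hx hy hz hg hd (not_lt.1 k1) (not_lt.1 k2)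
      (not_lt.1 k3)).dotProduct_mulVec_pos hw

end Triangle

/-! ### Consequences of the structure conditions -/

section Structure

variable {e₁ e₂ e₃ h₁ h₂ h₃ S₁ S₂ S₃ C₁ C₂ C₃ : ℝ}

/-- Here `S` stands for `e^f` and `C` for `√(1 + ε e^(2f))`. The determinant expands, using `e ^ 2 =
e`, into a positive multiple of the product of the three edge conditions plus the corner conditions
times nonnegative binary forms. -/
theorem lengthDet_pos (he₁ : e₁ = 0 ∨ e₁ = 1) (he₂ : e₂ = 0 ∨ e₂ = 1) (he₃ : e₃ = 0 ∨ e₃ = 1)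
    (hS₁ : 0 < S₁) (hS₂ : 0 < S₂) (hS₃ : 0 < S₃) (hC₁ : 0 < C₁) (hC₂ : 0 < C₂) (hC₃ : 0 < C₃)
    (q₁ : C₁ ^ 2 = 1 + e₁ * S₁ ^ 2) (q₂ : C₂ ^ 2 = 1 + e₂ * S₂ ^ 2) (q₃ : C₃ ^ 2 = 1 + e₃ * S₃ ^ 2)
    (s₁ : 0 < e₂ * e₃ + h₁) (s₂ : 0 < e₃ * e₁ + h₂) (s₃ : 0 < e₁ * e₂ + h₃)
    (t₁ : 0 ≤ e₁ * h₁ + h₂ * h₃) (t₂ : 0 ≤ e₂ * h₂ + h₃ * h₁) (t₃ : 0 ≤ e₃ * h₃ + h₁ * h₂) :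
    0 < lengthDet (C₂ * C₃ + h₁ * (S₂ * S₃)) (C₃ * C₁ + h₂ * (S₃ * S₁))
      (C₁ * C₂ + h₃ * (S₁ * S₂)) C₁ C₂ C₃ := by
  have key : ∀ {e f : ℝ}, (e = 0 ∨ e = 1) → (f = 0 ∨ f = 1) → ∀ s t : ℝ,
      0 ≤ e * s ^ 2 + f * t ^ 2 - 2 * e * f * (s * t) := by
    rintro e f (rfl | rfl) (rfl | rfl) s t <;> nlinarith [sq_nonneg (s - t)]
  have i₁ : e₁ ^ 2 = e₁ := by rcases he₁ with rfl | rfl <;> norm_num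
  have i₂ : e₂ ^ 2 = e₂ := by rcases he₂ with rfl | rfl <;> norm_num
  have i₃ : e₃ ^ 2 = e₃ := by rcases he₃ with rfl | rfl <;> norm_num
  have a₁₂ : C₁ * (C₁ * C₂ + h₃ * (S₁ * S₂)) - C₂ = S₁ * (e₁ * S₁ * C₂ + h₃ * S₂ * C₁) := by
    linear_combination C₂ * q₁
  have a₂₁ : C₂ * (C₁ * C₂ + h₃ * (S₁ * S₂)) - C₁ = S₂ * (e₂ * S₂ * C₁ + h₃ * S₁ * C₂) := by
    linear_combination C₁ * q₂
  have a₂₃ : C₂ * (C₂ * C₃ + h₁ * (S₂ * S₃)) - C₃ = S₂ * (e₂ * S₂ * C₃ + h₁ * S₃ * C₂) := by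
    linear_combination C₃ * q₂
  have a₃₂ : C₃ * (C₂ * C₃ + h₁ * (S₂ * S₃)) - C₂ = S₃ * (e₃ * S₃ * C₂ + h₁ * S₂ * C₃) := by
    linear_combination C₂ * q₃
  have a₃₁ : C₃ * (C₃ * C₁ + h₂ * (S₃ * S₁)) - C₁ = S₃ * (e₃ * S₃ * C₁ + h₂ * S₁ * C₃) := by
    linear_combination C₁ * q₃
  have a₁₃ : C₁ * (C₃ * C₁ + h₂ * (S₃ * S₁)) - C₃ = S₁ * (e₁ * S₁ * C₃ + h₂ * S₃ * C₁) := by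
    linear_combination C₃ * q₁
  have hsum : lengthDet (C₂ * C₃ + h₁ * (S₂ * S₃)) (C₃ * C₁ + h₂ * (S₃ * S₁))
      (C₁ * C₂ + h₃ * (S₁ * S₂)) C₁ C₂ C₃ = S₁ * S₂ * S₃ *
      (2 * (S₁ * S₂ * S₃ * (C₁ * C₂ * C₃)) *
          ((e₂ * e₃ + h₁) * (e₃ * e₁ + h₂) * (e₁ * e₂ + h₃)) +
        ((e₁ * h₁ + h₂ * h₃) * (C₁ * S₁) * (e₂ * (C₃ * S₂) ^ 2 + e₃ * (C₂ * S₃) ^ 2 -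
            2 * e₂ * e₃ * ((C₃ * S₂) * (C₂ * S₃))) +
         (e₂ * h₂ + h₃ * h₁) * (C₂ * S₂) * (e₃ * (C₁ * S₃) ^ 2 + e₁ * (C₃ * S₁) ^ 2 -
            2 * e₃ * e₁ * ((C₁ * S₃) * (C₃ * S₁))) +
         (e₃ * h₃ + h₁ * h₂) * (C₃ * S₃) * (e₁ * (C₂ * S₁) ^ 2 + e₂ * (C₁ * S₂) ^ 2 -
            2 * e₁ * e₂ * ((C₂ * S₁) * (C₁ * S₂))))) := by
    unfold lengthDet
    rw [a₁₂, a₂₁, a₂₃, a₃₂, a₃₁, a₁₃]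
    rcases he₁ with rfl | rfl <;> rcases he₂ with rfl | rfl <;> rcases he₃ with rfl | rfl <;> ring
  rw [hsum]
  have := key he₂ he₃ (C₃ * S₂) (C₂ * S₃)
  have := key he₃ he₁ (C₁ * S₃) (C₃ * S₁)
  have := key he₁ he₂ (C₂ * S₁) (C₁ * S₂)
  positivity

/-- The only summand of the weight that can be negative contains `e₁ * e₂ - h₃ ^ 2`. If `h₃ ≤ 0`,
the edge condition forces `e₁ * e₂ = 1` and `h₃ > -1`, and the summand is nonnegative. So a negative
weight needs `h₃ > 0`, from which both inequalities follow. -/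
theorem pos_of_centerCoord_neg (he₁ : e₁ = 0 ∨ e₁ = 1) (he₂ : e₂ = 0 ∨ e₂ = 1)
    (hS₁ : 0 < S₁) (hS₂ : 0 < S₂) (hS₃ : 0 < S₃) (hC₁ : 0 < C₁) (hC₂ : 0 < C₂) (hC₃ : 0 < C₃)
    (q₁ : C₁ ^ 2 = 1 + e₁ * S₁ ^ 2) (q₂ : C₂ ^ 2 = 1 + e₂ * S₂ ^ 2)
    (s₃ : 0 < e₁ * e₂ + h₃)
    (t₁ : 0 ≤ e₁ * h₁ + h₂ * h₃) (t₂ : 0 ≤ e₂ * h₂ + h₃ * h₁)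
    (hneg : centerCoord (C₂ * C₃ + h₁ * (S₂ * S₃)) (C₃ * C₁ + h₂ * (S₃ * S₁))
      (C₁ * C₂ + h₃ * (S₁ * S₂)) C₁ C₂ C₃ < 0) :
    0 < C₁ * (C₁ * C₂ + h₃ * (S₁ * S₂)) - C₂ ∧ 0 < C₂ * (C₁ * C₂ + h₃ * (S₁ * S₂)) - C₁ := by
  have a₁₂ : C₁ * (C₁ * C₂ + h₃ * (S₁ * S₂)) - C₂ = S₁ * (e₁ * S₁ * C₂ + h₃ * S₂ * C₁) := by
    linear_combination C₂ * q₁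
  have a₂₁ : C₂ * (C₁ * C₂ + h₃ * (S₁ * S₂)) - C₁ = S₂ * (e₂ * S₂ * C₁ + h₃ * S₁ * C₂) := by
    linear_combination C₁ * q₂
  have hH : centerCoord (C₂ * C₃ + h₁ * (S₂ * S₃)) (C₃ * C₁ + h₂ * (S₃ * S₁))
      (C₁ * C₂ + h₃ * (S₁ * S₂)) C₁ C₂ C₃ = S₁ ^ 2 * S₂ ^ 2 * C₃ * (e₁ * e₂ - h₃ ^ 2) +
      S₁ * S₂ * S₃ * (S₂ * C₁ * (e₂ * h₂ + h₃ * h₁) + S₁ * C₂ * (e₁ * h₁ + h₂ * h₃)) := by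
    unfold centerCoord
    have q₁' : C₁ ^ 2 - 1 - e₁ * S₁ ^ 2 = 0 := by linarith
    have q₂' : C₂ ^ 2 - 1 - e₂ * S₂ ^ 2 = 0 := by linarith
    linear_combination (C₃ * C₂ ^ 2 - C₃ + S₂ * S₃ * C₂ * h₁) * q₁' +
      (C₃ * S₁ ^ 2 * e₁ + S₁ * S₃ * C₁ * h₂) * q₂'
  have e0₁ : 0 ≤ e₁ := by rcases he₁ with rfl | rfl <;> norm_num
  have e0₂ : 0 ≤ e₂ := by rcases he₂ with rfl | rfl <;> norm_num
  have hh : 0 < h₃ := by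
    by_contra hcon
    have : 0 ≤ e₁ * e₂ - h₃ ^ 2 := by
      rcases he₁ with rfl | rfl <;> rcases he₂ with rfl | rfl <;> nlinarith
    refine hneg.not_ge ?_
    rw [hH]
    positivity
  rw [a₁₂, a₂₁]
  constructor <;> positivity

end Structure

end DiscreteConformal

/-! ### A monotonicity criterion in one variable -/

namespace DiscreteConformal

open Set

/-- A continuous function which is nonincreasing wherever it avoids a finite set of values is
nonincreasing. -/
theorem le_of_deriv_nonpos_or_mem_finite {φ : ℝ → ℝ} {a b : ℝ} (hab : a ≤ b)
    (hφ : ContinuousOn φ (Icc a b)) {S : Set ℝ} (hS : S.Finite)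
    (h : ∀ t ∈ Ioo a b, φ t ∈ S ∨ ∃ d ≤ 0, HasDerivAt φ d t) : φ b ≤ φ a := by
  by_contra! hlt
  -- A window `[y, y + δ / 2]` of values between `φ a` and `φ b` that misses `S`. Between the last
  -- time `t₁` below the window and the next time `t₂` above it, `φ` would rise although its
  -- derivative is nonpositive.
  obtain ⟨y, hy, hyS⟩ := ((Ioo_infinite hlt).sdiff hS).nonempty
  have hopen : IsOpen (Ioo (φ a) (φ b) \ S) := isOpen_Ioo.sdiff hS.isClosed
  obtain ⟨δ, hδ, hball⟩ := Metric.isOpen_iff.1 hopen y ⟨hy, hyS⟩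
  have hin : ∀ y' ∈ Icc y (y + δ / 2), y' ∈ Ioo (φ a) (φ b) \ S := fun y' hy' => by
    refine hball ?_
    rw [Metric.mem_ball, Real.dist_eq, abs_lt]
    constructor <;> linarith [hy'.1, hy'.2]
  have hA : IsCompact (Icc a b ∩ φ ⁻¹' Iic y) :=
    isCompact_Icc.of_isClosed_subset (hφ.preimage_isClosed_of_isClosed isClosed_Icc isClosed_Iic)
      inter_subset_left
  obtain ⟨t₁, ⟨ht₁, hφ₁⟩, hmax⟩ :=
    hA.exists_isGreatest ⟨a, left_mem_Icc.2 hab, hy.1.le⟩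
  have hsub : Icc t₁ b ⊆ Icc a b := Icc_subset_Icc_left ht₁.1
  have hB : IsCompact (Icc t₁ b ∩ φ ⁻¹' Ici (y + δ / 2)) :=
    isCompact_Icc.of_isClosed_subset
      ((hφ.mono hsub).preimage_isClosed_of_isClosed isClosed_Icc isClosed_Ici) inter_subset_left
  obtain ⟨t₂, ⟨ht₂, hφ₂⟩, hmin⟩ :=
    hB.exists_isLeast ⟨b, right_mem_Icc.2 ht₁.2,
      (hin (y + δ / 2) (right_mem_Icc.2 (by linarith))).1.2.le⟩
  have hd : ∀ t ∈ Ioo t₁ t₂, ∃ d ≤ 0, HasDerivAt φ d t := fun t ht => by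
    have htab : t ∈ Icc a b := ⟨ht₁.1.trans ht.1.le, ht.2.le.trans ht₂.2⟩
    have h1 : y < φ t := by
      by_contra! hcon
      exact (hmax ⟨htab, hcon⟩).not_gt ht.1
    have h2 : φ t < y + δ / 2 := by
      by_contra! hcon
      exact (hmin ⟨⟨ht.1.le, htab.2⟩, hcon⟩).not_gt ht.2
    exact (h t ⟨ht₁.1.trans_lt ht.1, ht.2.trans_le ht₂.2⟩).resolve_left
      (hin _ ⟨h1.le, h2.le⟩).2
  have hanti : AntitoneOn φ (Icc t₁ t₂) := by
    refine antitoneOn_of_deriv_nonpos (convex_Icc _ _)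
      (hφ.mono (Icc_subset_Icc ht₁.1 ht₂.2)) ?_ ?_ <;> rw [interior_Icc]
    · intro t ht
      obtain ⟨d, -, hd⟩ := hd t ht
      exact hd.differentiableAt.differentiableWithinAt
    · intro t ht
      obtain ⟨d, h0, hd⟩ := hd t ht
      rwa [hd.deriv]
  have := hanti (left_mem_Icc.2 ht₂.1) (right_mem_Icc.2 ht₂.1) ht₂.1
  simp only [mem_preimage, mem_Iic, mem_Ici] at hφ₁ hφ₂
  linarith

/-! ### The hyperbolic cosine law and its derivative -/

section CosineLaw

/-- The cosine of an angle of a hyperbolic triangle in terms of the hyperbolic cosines of the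
opposite side and of the two adjacent sides. -/
noncomputable def cornerCos (x y z : ℝ) : ℝ := (y * z - x) / (√(y ^ 2 - 1) * √(z ^ 2 - 1))

variable {x y z : ℝ}

theorem one_sub_cornerCos_sq (hy : 1 < y) (hz : 1 < z) :
    1 - cornerCos x y z ^ 2 = gramDet x y z / ((y ^ 2 - 1) * (z ^ 2 - 1)) := by
  have k2 : 0 < y ^ 2 - 1 := by nlinarith
  have k3 : 0 < z ^ 2 - 1 := by nlinarith
  unfold cornerCos gramDet
  rw [div_pow, mul_pow, Real.sq_sqrt k2.le, Real.sq_sqrt k3.le]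
  field_simp
  ring

/-- A nonpositive Gram determinant means a cosine of modulus at least one, where `Real.arccos` is
constant. -/
theorem arccos_cornerCos_of_gramDet_nonpos (hy : 1 < y) (hz : 1 < z) (h : gramDet x y z ≤ 0) :
    Real.arccos (cornerCos x y z) = Real.pi ∨ Real.arccos (cornerCos x y z) = 0 := by
  have k2 : 0 < y ^ 2 - 1 := by nlinarith
  have k3 : 0 < z ^ 2 - 1 := by nlinarith
  have hsq := one_sub_cornerCos_sq (x := x) hy hz
  have : gramDet x y z / ((y ^ 2 - 1) * (z ^ 2 - 1)) ≤ 0 :=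
    div_nonpos_of_nonpos_of_nonneg h (by positivity)
  have h1 : 1 ≤ |cornerCos x y z| := by
    rw [← one_le_sq_iff_one_le_abs]; linarith
  rcases le_abs.1 h1 with h1 | h1
  · exact Or.inr (Real.arccos_of_one_le h1)
  · exact Or.inl (Real.arccos_eq_pi.2 (by linarith))

theorem cornerCos_sq_lt_one (hy : 1 < y) (hz : 1 < z) (h : 0 < gramDet x y z) :
    cornerCos x y z ^ 2 < 1 := by
  have k2 : 0 < y ^ 2 - 1 := by nlinarith
  have k3 : 0 < z ^ 2 - 1 := by nlinarith
  have hsq := one_sub_cornerCos_sq (x := x) hy hz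
  have : 0 < gramDet x y z / ((y ^ 2 - 1) * (z ^ 2 - 1)) := by positivity
  linarith

theorem cornerCos_ne (hy : 1 < y) (hz : 1 < z) (h : 0 < gramDet x y z) :
    cornerCos x y z ≠ -1 ∧ cornerCos x y z ≠ 1 := by
  have := cornerCos_sq_lt_one hy hz h
  constructor <;> intro h1 <;> rw [h1] at this <;> norm_num at this

/-- Written with the denominator `√(gramDet ..)`, which is symmetric in the sides and hence common
to the three angles. -/
theorem hasDerivAt_arccos_cornerCos {x y z : ℝ → ℝ} {x' y' z' t : ℝ} (hx : HasDerivAt x x' t)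
    (hy : HasDerivAt y y' t) (hz : HasDerivAt z z' t) (hy1 : 1 < y t) (hz1 : 1 < z t)
    (hg : 0 < gramDet (x t) (y t) (z t)) :
    HasDerivAt (fun s => Real.arccos (cornerCos (x s) (y s) (z s)))
      ((x' - y' * ((x t * y t - z t) / (y t ^ 2 - 1)) - z' * ((x t * z t - y t) / (z t ^ 2 - 1))) /
        √(gramDet (x t) (y t) (z t))) t := by
  have k2 : 0 < y t ^ 2 - 1 := by nlinarith
  have k3 : 0 < z t ^ 2 - 1 := by nlinarith
  have hne := cornerCos_ne hy1 hz1 hg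
  have dp := ((hy.fun_pow 2).sub_const 1).sqrt k2.ne'
  have dq := ((hz.fun_pow 2).sub_const 1).sqrt k3.ne'
  have hp : 0 < √(y t ^ 2 - 1) := Real.sqrt_pos.2 k2
  have hq : 0 < √(z t ^ 2 - 1) := Real.sqrt_pos.2 k3
  have dc := ((hy.mul hz).sub hx).div (dp.mul dq) (mul_pos hp hq).ne'
  have dd := (Real.hasDerivAt_arccos hne.1 hne.2).comp t dc
  refine dd.congr_deriv ?_
  rw [one_sub_cornerCos_sq hy1 hz1, Real.sqrt_div hg.le, Real.sqrt_mul k2.le]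
  have hp2 : y t ^ 2 - 1 = √(y t ^ 2 - 1) ^ 2 := (Real.sq_sqrt k2.le).symm
  have hq2 : z t ^ 2 - 1 = √(z t ^ 2 - 1) ^ 2 := (Real.sq_sqrt k3.le).symm
  have hA : 0 < √(gramDet (x t) (y t) (z t)) := Real.sqrt_pos.2 hg
  simp only [Pi.mul_apply, Pi.sub_apply]
  generalize √(gramDet (x t) (y t) (z t)) = A at *
  generalize √(y t ^ 2 - 1) = p at *
  generalize √(z t ^ 2 - 1) = q at *
  rw [hp2, hq2]
  generalize x t = x at *
  generalize y t = y at *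
  generalize z t = z at *
  field_simp
  norm_num
  linear_combination 2 * y' * z * q ^ 2 * hp2 + 2 * z' * y * p ^ 2 * hq2

theorem differentiableAt_arccos_cornerCos {E : Type*} [NormedAddCommGroup E] [NormedSpace ℝ E]
    {x y z : E → ℝ} {p : E} (hx : DifferentiableAt ℝ x p) (hy : DifferentiableAt ℝ y p)
    (hz : DifferentiableAt ℝ z p) (hy1 : 1 < y p) (hz1 : 1 < z p)
    (hg : 0 < gramDet (x p) (y p) (z p)) :
    DifferentiableAt ℝ (fun s => Real.arccos (cornerCos (x s) (y s) (z s))) p := by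
  have k2 : y p ^ 2 - 1 ≠ 0 := by nlinarith
  have k3 : z p ^ 2 - 1 ≠ 0 := by nlinarith
  have hp : √(y p ^ 2 - 1) ≠ 0 := (Real.sqrt_pos.2 (by nlinarith)).ne'
  have hq : √(z p ^ 2 - 1) ≠ 0 := (Real.sqrt_pos.2 (by nlinarith)).ne'
  have dc : DifferentiableAt ℝ (fun s => cornerCos (x s) (y s) (z s)) p := by
    simp only [cornerCos, div_eq_mul_inv]
    exact ((hy.mul hz).sub hx).mul (((((hy.pow 2).sub_const 1).sqrt k2).mul
      (((hz.pow 2).sub_const 1).sqrt k3)).fun_inv (mul_ne_zero hp hq))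
  exact DifferentiableAt.comp (g := Real.arccos) p
    (Real.differentiableAt_arccos.2 (cornerCos_ne hy1 hz1 hg)) dc

theorem continuousAt_arccos_cornerCos {E : Type*} [TopologicalSpace E]
    {x y z : E → ℝ} {p : E} (hx : ContinuousAt x p) (hy : ContinuousAt y p)
    (hz : ContinuousAt z p) (hy1 : 1 < y p) (hz1 : 1 < z p) :
    ContinuousAt (fun s => Real.arccos (cornerCos (x s) (y s) (z s))) p := by
  have hp : √(y p ^ 2 - 1) ≠ 0 := (Real.sqrt_pos.2 (by nlinarith)).ne'
  have hq : √(z p ^ 2 - 1) ≠ 0 := (Real.sqrt_pos.2 (by nlinarith)).ne'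
  exact Real.continuous_arccos.continuousAt.comp (((hy.mul hz).sub hx).div
    ((((hy.pow 2).sub continuousAt_const).sqrt).mul (((hz.pow 2).sub continuousAt_const).sqrt))
    (mul_ne_zero hp hq))

end CosineLaw

/-! ### Edge lengths in the coordinates `u` -/

section Coordinates

open Real

/-- `e ^ f` as a function of the coordinate `u` of `f`. -/
noncomputable def sCoord (e u : ℝ) : ℝ := if e = 0 then exp u else (sinh (-u))⁻¹

/-- `√(1 + e * exp (2 * f))` as a function of the coordinate `u` of `f`. -/
noncomputable def cCoord (e u : ℝ) : ℝ := if e = 0 then 1 else cosh u / sinh (-u)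

variable {e u : ℝ}

theorem sCoord_pos (hu : e = 1 → u < 0) (he : e = 0 ∨ e = 1) : 0 < sCoord e u := by
  rcases he with rfl | rfl
  · simp [sCoord, exp_pos]
  · simp only [sCoord, one_ne_zero, if_false, inv_pos, sinh_pos_iff]
    linarith [hu rfl]

theorem cCoord_pos (hu : e = 1 → u < 0) (he : e = 0 ∨ e = 1) : 0 < cCoord e u := by
  rcases he with rfl | rfl
  · simp [cCoord]
  · simp only [cCoord, one_ne_zero, if_false]
    exact div_pos (cosh_pos u) (sinh_pos_iff.2 (by linarith [hu rfl]))

theorem cCoord_sq (hu : e = 1 → u < 0) (he : e = 0 ∨ e = 1) :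
    cCoord e u ^ 2 = 1 + e * sCoord e u ^ 2 := by
  rcases he with rfl | rfl
  · simp [cCoord]
  · have : 0 < sinh (-u) := sinh_pos_iff.2 (by linarith [hu rfl])
    simp only [cCoord, sCoord, one_ne_zero, if_false]
    field_simp
    rw [sinh_neg, cosh_sq]
    ring

/-- The coordinate `u` is made so that `df/du = √(1 + ε e^(2f))`; this relation makes the matrix of
angle derivatives symmetric. -/
theorem hasDerivAt_sCoord (hu : e = 1 → u < 0) (he : e = 0 ∨ e = 1) :
    HasDerivAt (sCoord e) (sCoord e u * cCoord e u) u := by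
  rcases he with rfl | rfl
  · have : sCoord 0 = exp := by ext; simp [sCoord]
    simpa [this, cCoord] using hasDerivAt_exp u
  · have hs : 0 < sinh (-u) := sinh_pos_iff.2 (by linarith [hu rfl])
    have : sCoord 1 = fun u => (sinh (-u))⁻¹ := by ext; simp [sCoord]
    rw [this]
    refine ((hasDerivAt_neg u).sinh.inv hs.ne').congr_deriv ?_
    simp only [cCoord, one_ne_zero, if_false, cosh_neg]
    field_simp

theorem hasDerivAt_cCoord (hu : e = 1 → u < 0) (he : e = 0 ∨ e = 1) :
    HasDerivAt (cCoord e) (e * sCoord e u ^ 2) u := by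
  rcases he with rfl | rfl
  · have : cCoord 0 = fun _ => 1 := by ext; simp [cCoord]
    simpa [this] using hasDerivAt_const u (1 : ℝ)
  · have hs : 0 < sinh (-u) := sinh_pos_iff.2 (by linarith [hu rfl])
    have : cCoord 1 = fun u => cosh u / sinh (-u) := by ext; simp [cCoord]
    rw [this]
    refine ((hasDerivAt_cosh u).div (hasDerivAt_neg u).sinh hs.ne').congr_deriv ?_
    simp only [sCoord, one_ne_zero, if_false, cosh_neg]
    field_simp
    rw [sinh_neg]
    nlinarith [cosh_sq u]

/-- The hyperbolic cosine of the length of an edge. -/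
noncomputable def coshSide (e₁ e₂ h u₁ u₂ : ℝ) : ℝ :=
  cCoord e₁ u₁ * cCoord e₂ u₂ + h * (sCoord e₁ u₁ * sCoord e₂ u₂)

/-- Cauchy–Schwarz gives `C₁ * C₂ ≥ 1 + e₁ * e₂ * (S₁ * S₂)`, and the edge condition does the rest.
Thus lengths are always positive, and only the triangle inequalities can fail. -/
theorem one_lt_coshSide {e₁ e₂ h u₁ u₂ : ℝ} (he₁ : e₁ = 0 ∨ e₁ = 1) (he₂ : e₂ = 0 ∨ e₂ = 1)
    (hu₁ : e₁ = 1 → u₁ < 0) (hu₂ : e₂ = 1 → u₂ < 0) (hh : 0 < e₁ * e₂ + h) :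
    1 < coshSide e₁ e₂ h u₁ u₂ := by
  have s₁ := sCoord_pos hu₁ he₁
  have s₂ := sCoord_pos hu₂ he₂
  have c₁ := cCoord_pos hu₁ he₁
  have c₂ := cCoord_pos hu₂ he₂
  have q₁ := cCoord_sq hu₁ he₁
  have q₂ := cCoord_sq hu₂ he₂
  unfold coshSide
  generalize sCoord e₁ u₁ = S₁ at *
  generalize sCoord e₂ u₂ = S₂ at *
  generalize cCoord e₁ u₁ = C₁ at *
  generalize cCoord e₂ u₂ = C₂ at *
  have h1 : 1 + e₁ * e₂ * (S₁ * S₂) ≤ C₁ * C₂ := by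
    refine abs_le_of_sq_le_sq' ?_ (by positivity) |>.2
    rw [mul_pow, q₁, q₂]
    rcases he₁ with rfl | rfl <;> rcases he₂ with rfl | rfl <;>
      nlinarith [sq_nonneg (S₁ - S₂), sq_nonneg S₁, sq_nonneg S₂]
  have := mul_pos hh (mul_pos s₁ s₂)
  nlinarith

/-- The coefficients of `w₁` and `w₂` are the entries whose determinant is `lengthDet`. -/
theorem hasDerivAt_coshSide {e₁ e₂ h : ℝ} (he₁ : e₁ = 0 ∨ e₁ = 1) (he₂ : e₂ = 0 ∨ e₂ = 1)
    {u₁ u₂ : ℝ → ℝ} {t w₁ w₂ : ℝ} (hu₁ : e₁ = 1 → u₁ t < 0) (hu₂ : e₂ = 1 → u₂ t < 0)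
    (d₁ : HasDerivAt u₁ w₁ t) (d₂ : HasDerivAt u₂ w₂ t) :
    HasDerivAt (fun s => coshSide e₁ e₂ h (u₁ s) (u₂ s))
      (w₁ * (cCoord e₁ (u₁ t) * coshSide e₁ e₂ h (u₁ t) (u₂ t) - cCoord e₂ (u₂ t)) +
       w₂ * (cCoord e₂ (u₂ t) * coshSide e₁ e₂ h (u₁ t) (u₂ t) - cCoord e₁ (u₁ t))) t := by
  have ds₁ := (hasDerivAt_sCoord hu₁ he₁).comp t d₁
  have ds₂ := (hasDerivAt_sCoord hu₂ he₂).comp t d₂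
  have dc₁ := (hasDerivAt_cCoord hu₁ he₁).comp t d₁
  have dc₂ := (hasDerivAt_cCoord hu₂ he₂).comp t d₂
  refine ((dc₁.mul dc₂).add ((ds₁.mul ds₂).const_mul h)).congr_deriv ?_
  simp only [Function.comp, coshSide]
  linear_combination -w₁ * cCoord e₂ (u₂ t) * cCoord_sq hu₁ he₁ -
    w₂ * cCoord e₁ (u₁ t) * cCoord_sq hu₂ he₂

theorem differentiableAt_coshSide {E : Type*} [NormedAddCommGroup E] [NormedSpace ℝ E]
    {e₁ e₂ h : ℝ} (he₁ : e₁ = 0 ∨ e₁ = 1) (he₂ : e₂ = 0 ∨ e₂ = 1)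
    {u₁ u₂ : E → ℝ} {p : E} (hu₁ : e₁ = 1 → u₁ p < 0) (hu₂ : e₂ = 1 → u₂ p < 0)
    (d₁ : DifferentiableAt ℝ u₁ p) (d₂ : DifferentiableAt ℝ u₂ p) :
    DifferentiableAt ℝ (fun s => coshSide e₁ e₂ h (u₁ s) (u₂ s)) p :=
  ((((hasDerivAt_cCoord hu₁ he₁).differentiableAt.comp p d₁).mul
    ((hasDerivAt_cCoord hu₂ he₂).differentiableAt.comp p d₂)).add
    ((((hasDerivAt_sCoord hu₁ he₁).differentiableAt.comp p d₁).mul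
    ((hasDerivAt_sCoord hu₂ he₂).differentiableAt.comp p d₂)).const_mul h))

end Coordinates

end DiscreteConformal

namespace DiscreteConformal

open Set Real

/-! ### Monotonicity of the extended angles of one triangle -/

section Triangle

/-- The hyperbolic cosines of the sides of a triangle. -/
noncomputable def triSide (e h u : Fin 3 → ℝ) (k : Fin 3) : ℝ :=
  coshSide (e (k + 1)) (e (k + 2)) (h k) (u (k + 1)) (u (k + 2))

/-- The extended angles of a triangle. -/
noncomputable def triAngle (e h u : Fin 3 → ℝ) (k : Fin 3) : ℝ :=
  arccos (cornerCos (triSide e h u k) (triSide e h u (k + 1)) (triSide e h u (k + 2)))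

/-- The structure conditions of a triangle. -/
structure IsStructure (e h : Fin 3 → ℝ) : Prop where
  weight : ∀ k, e k = 0 ∨ e k = 1
  edge : ∀ k, 0 < e (k + 1) * e (k + 2) + h k
  corner : ∀ k, 0 ≤ e k * h k + h (k + 1) * h (k + 2)

/-- The set of coordinates of generalized hyperbolic discrete conformal factors. -/
def admissible {ι : Type*} (e : ι → ℝ) : Set (ι → ℝ) := {u | ∀ i, e i = 1 → u i < 0}

theorem convex_admissible {ι : Type*} (e : ι → ℝ) : Convex ℝ (admissible e) := by
  intro u hu v hv a b ha hb hab i hi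
  have h1 := hu i hi
  have h2 := hv i hi
  simp only [Pi.add_apply, Pi.smul_apply, smul_eq_mul]
  rcases ha.eq_or_lt with rfl | ha
  · have : b = 1 := by linarith
    subst this; linarith
  · nlinarith

variable {e h u : Fin 3 → ℝ}

theorem IsStructure.one_lt_triSide (H : IsStructure e h) (hu : u ∈ admissible e) (k : Fin 3) :
    1 < triSide e h u k :=
  one_lt_coshSide (H.weight _) (H.weight _) (hu _) (hu _) (H.edge k)

/-- The Gram determinant of a triangle. -/
noncomputable def triGram (e h u : Fin 3 → ℝ) : ℝ :=
  gramDet (triSide e h u 0) (triSide e h u 1) (triSide e h u 2)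

theorem triGram_eq (k : Fin 3) :
    gramDet (triSide e h u k) (triSide e h u (k + 1)) (triSide e h u (k + 2)) = triGram e h u := by
  unfold triGram
  fin_cases k
  · rfl
  · exact gramDet_rotate
  · exact gramDet_rotate.symm

theorem IsStructure.triAngle_of_triGram_nonpos (H : IsStructure e h) (hu : u ∈ admissible e)
    (hg : triGram e h u ≤ 0) (k : Fin 3) : triAngle e h u k = π ∨ triAngle e h u k = 0 :=
  arccos_cornerCos_of_gramDet_nonpos (H.one_lt_triSide hu _) (H.one_lt_triSide hu _)
    ((triGram_eq k).trans_le hg)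

/-- The derivative is minus the form of `angleMatrix` at `w`, divided by the root of the Gram
determinant. -/
theorem IsStructure.exists_hasDerivAt (H : IsStructure e h) {p w : Fin 3 → ℝ} {t : ℝ}
    (hu : p + t • w ∈ admissible e) (hg : 0 < triGram e h (p + t • w)) :
    ∃ d ≤ 0, (w ≠ 0 → d < 0) ∧
      HasDerivAt (fun s : ℝ => ∑ k, w k * triAngle e h (p + s • w) k) d t := by
  have dl : ∀ i, HasDerivAt (fun s : ℝ => (p + s • w) i) (w i) t := fun i => by
    simpa using ((hasDerivAt_id t).mul_const (w i)).const_add (p i)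
  have ds : ∀ k, HasDerivAt (fun s : ℝ => triSide e h (p + s • w) k) _ t := fun k =>
    hasDerivAt_coshSide (h := h k) (H.weight (k + 1)) (H.weight (k + 2)) (hu _) (hu _)
      (dl (k + 1)) (dl (k + 2))
  have hone := H.one_lt_triSide hu
  have da : ∀ k, HasDerivAt (fun s : ℝ => triAngle e h (p + s • w) k) _ t := fun k =>
    hasDerivAt_arccos_cornerCos (ds k) (ds (k + 1)) (ds (k + 2)) (hone _) (hone _)
      ((triGram_eq k).symm ▸ hg)
  have dsum := HasDerivAt.fun_sum (u := Finset.univ) fun k _ => (da k).const_mul (w k)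
  have hA : 0 < √(triGram e h (p + t • w)) := sqrt_pos.2 hg
  set v := p + t • w with hv
  set g := triSide e h v with hgdef
  set C : Fin 3 → ℝ := fun i => cCoord (e i) (v i) with hC
  set S : Fin 3 → ℝ := fun i => sCoord (e i) (v i) with hS
  have hSpos : ∀ i, 0 < S i := fun i => sCoord_pos (hu i) (H.weight i)
  have hCpos : ∀ i, 0 < C i := fun i => cCoord_pos (hu i) (H.weight i)
  have hCS : ∀ i, C i ^ 2 = 1 + e i * S i ^ 2 := fun i => cCoord_sq (hu i) (H.weight i)
  have e0 : g 0 = C 1 * C 2 + h 0 * (S 1 * S 2) := rfl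
  have e1 : g 1 = C 2 * C 0 + h 1 * (S 2 * S 0) := rfl
  have e2 : g 2 = C 0 * C 1 + h 2 * (S 0 * S 1) := rfl
  have s0 : 0 < e 1 * e 2 + h 0 := H.edge 0
  have s1 : 0 < e 2 * e 0 + h 1 := H.edge 1
  have s2 : 0 < e 0 * e 1 + h 2 := H.edge 2
  have t0 : 0 ≤ e 0 * h 0 + h 1 * h 2 := H.corner 0
  have t1 : 0 ≤ e 1 * h 1 + h 2 * h 0 := H.corner 1
  have t2 : 0 ≤ e 2 * h 2 + h 0 * h 1 := H.corner 2
  have hpos : w ≠ 0 → 0 < w ⬝ᵥ (angleMatrix (g 0) (g 1) (g 2) (C 0) (C 1) (C 2)).mulVec w := by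
    refine angleMatrix_form_pos (hone 0) (hone 1) (hone 2) hg ?_ ?_ ?_ ?_ <;> rw [e0, e1, e2]
    · exact lengthDet_pos (H.weight 0) (H.weight 1) (H.weight 2) (hSpos 0) (hSpos 1) (hSpos 2)
        (hCpos 0) (hCpos 1) (hCpos 2) (hCS 0) (hCS 1) (hCS 2) s0 s1 s2 t0 t1 t2
    · exact pos_of_centerCoord_neg (H.weight 1) (H.weight 2) (hSpos 1) (hSpos 2) (hSpos 0)
        (hCpos 1) (hCpos 2) (hCpos 0) (hCS 1) (hCS 2) s0 t1 t2
    · exact pos_of_centerCoord_neg (H.weight 2) (H.weight 0) (hSpos 2) (hSpos 0) (hSpos 1)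
        (hCpos 2) (hCpos 0) (hCpos 1) (hCS 2) (hCS 0) s1 t2 t0
    · exact pos_of_centerCoord_neg (H.weight 0) (H.weight 1) (hSpos 0) (hSpos 1) (hSpos 2)
        (hCpos 0) (hCpos 1) (hCpos 2) (hCS 0) (hCS 1) s2 t0 t1
  have hd : -(w ⬝ᵥ (angleMatrix (g 0) (g 1) (g 2) (C 0) (C 1) (C 2)).mulVec w /
      √(triGram e h v)) ≤ 0 := by
    by_cases hw : w = 0
    · simp [hw]
    · have := hpos hw
      exact neg_nonpos.2 (by positivity)
  refine ⟨_, hd, fun hw => neg_neg_of_pos (div_pos (hpos hw) hA), dsum.congr_deriv ?_⟩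
  have k0 : g 0 ^ 2 - 1 ≠ 0 := by nlinarith [hone 0]
  have k1 : g 1 ^ 2 - 1 ≠ 0 := by nlinarith [hone 1]
  have k2 : g 2 ^ 2 - 1 ≠ 0 := by nlinarith [hone 2]
  have hsq : ∀ k, gramDet (g k) (g (k + 1)) (g (k + 2)) = triGram e h v := triGram_eq
  change ∑ k, w k * (((w (k + 1) * (C (k + 1) * g k - C (k + 2)) +
      w (k + 2) * (C (k + 2) * g k - C (k + 1))) -
    (w (k + 1 + 1) * (C (k + 1 + 1) * g (k + 1) - C (k + 1 + 2)) +
      w (k + 1 + 2) * (C (k + 1 + 2) * g (k + 1) - C (k + 1 + 1))) *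
        ((g k * g (k + 1) - g (k + 2)) / (g (k + 1) ^ 2 - 1)) -
    (w (k + 2 + 1) * (C (k + 2 + 1) * g (k + 2) - C (k + 2 + 2)) +
      w (k + 2 + 2) * (C (k + 2 + 2) * g (k + 2) - C (k + 2 + 1))) *
        ((g k * g (k + 2) - g (k + 1)) / (g (k + 2) ^ 2 - 1))) /
          √(gramDet (g k) (g (k + 1)) (g (k + 2)))) = _
  simp only [hsq, Fin.sum_univ_three, Fin.isValue, Fin.reduceAdd, zero_add]
  rw [angleMatrix_form]
  generalize √(triGram e h v) = A at *
  clear_value g C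
  clear e0 e1 e2 hpos hd ds da dsum dl hone hCS hCpos
  unfold centerCoord
  field_simp
  ring

/-- The derivative of the angle sum of a nondegenerate triangle is nonpositive, and the angles
are locally constant otherwise; hence the angles are monotone. -/
theorem IsStructure.sum_mul_triAngle_sub_nonpos (H : IsStructure e h) {p q : Fin 3 → ℝ}
    (hp : p ∈ admissible e) (hq : q ∈ admissible e) :
    ∑ k, (q k - p k) * (triAngle e h q k - triAngle e h p k) ≤ 0 := by
  set w := q - p with hw
  have hadm : ∀ t ∈ Icc (0 : ℝ) 1, p + t • w ∈ admissible e := fun t ht =>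
    (convex_admissible e).add_smul_sub_mem hp hq ht
  have hline : ∀ i t, HasDerivAt (fun s : ℝ => (p + s • w) i) (w i) t := fun i t => by
    simpa using ((hasDerivAt_id t).mul_const (w i)).const_add (p i)
  have hcont : ∀ k, ∀ t ∈ Icc (0 : ℝ) 1,
      ContinuousAt (fun s : ℝ => triSide e h (p + s • w) k) t := fun k t ht => by
    have := hasDerivAt_coshSide (h := h k) (u₁ := fun s => (p + s • w) (k + 1))
      (u₂ := fun s => (p + s • w) (k + 2)) (H.weight (k + 1)) (H.weight (k + 2))
      (hadm t ht (k + 1)) (hadm t ht (k + 2)) (hline (k + 1) t) (hline (k + 2) t)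
    exact this.continuousAt
  -- The at most eight values of the weighted angle sum when every angle is `0` or `π`. They replace
  -- any control on how the segment meets the degenerate region.
  have hfin : (range fun δ : Fin 3 → Bool => ∑ k, w k * (if δ k then π else 0)).Finite :=
    finite_range _
  have key := le_of_deriv_nonpos_or_mem_finite
    (φ := fun s : ℝ => ∑ k, w k * triAngle e h (p + s • w) k) zero_le_one ?_ hfin ?_
  · simp only [one_smul, zero_smul, add_zero, hw, add_sub_cancel] at key
    simp only [Pi.sub_apply] at key
    simp only [mul_sub, Finset.sum_sub_distrib]
    linarith
  · refine fun t ht => ContinuousAt.continuousWithinAt ?_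
    refine tendsto_finsetSum _ fun k _ => ContinuousAt.mul continuousAt_const ?_
    exact continuousAt_arccos_cornerCos (hcont _ t ht) (hcont _ t ht) (hcont _ t ht)
      (H.one_lt_triSide (hadm t ht) _) (H.one_lt_triSide (hadm t ht) _)
  · intro t ht
    have hu := hadm t (Ioo_subset_Icc_self ht)
    rcases le_or_gt (triGram e h (p + t • w)) 0 with hg | hg
    · refine Or.inl ⟨fun k => decide (triAngle e h (p + t • w) k = π), ?_⟩
      refine Finset.sum_congr rfl fun k _ => ?_
      rcases H.triAngle_of_triGram_nonpos hu hg k with h1 | h1 <;> simp [h1, pi_ne_zero.symm]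
    · obtain ⟨d, hd, -, hd'⟩ := H.exists_hasDerivAt hu hg
      exact Or.inr ⟨d, hd, hd'⟩

end Triangle

end DiscreteConformal

namespace DiscreteConformal

open Set Filter Topology

/-! ### Dissipative differential equations with a continuous field -/

section ODE

variable {ι : Type*} [Fintype ι]

/-- Two curves with the same initial value whose velocities differ, up to an error `δ`, by a
dissipative term stay close. -/
theorem sum_sq_sub_le_of_dissipative {y z y' z' : ℝ → ι → ℝ} {T δ : ℝ} {I : Set ℝ}
    (hI : Icc 0 T ⊆ I)
    (hy : ∀ t ∈ Icc 0 T, ∀ i, HasDerivWithinAt (fun s => y s i) (y' t i) I t)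
    (hz : ∀ t ∈ Icc 0 T, ∀ i, HasDerivWithinAt (fun s => z s i) (z' t i) I t)
    (h0 : y 0 = z 0)
    (hd : ∀ t ∈ Ico 0 T, ∑ i, (y t i - z t i) * (y' t i - z' t i) ≤ δ * ∑ i, |y t i - z t i|) :
    ∀ t ∈ Icc 0 T, ∑ i, (y t i - z t i) ^ 2 ≤ Fintype.card ι * δ ^ 2 * (Real.exp t - 1) := by
  have hderiv : ∀ t ∈ Icc 0 T, HasDerivWithinAt (fun s => ∑ i, (y s i - z s i) ^ 2)
      (2 * ∑ i, (y t i - z t i) * (y' t i - z' t i)) (Icc 0 T) t := fun t ht => by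
    have := HasDerivWithinAt.fun_sum (u := Finset.univ) fun i _ =>
      ((((hy t ht i).sub (hz t ht i)).mono hI).fun_pow 2)
    refine this.congr_deriv ?_
    rw [Finset.mul_sum]
    refine Finset.sum_congr rfl fun i _ => ?_
    simp only [Pi.sub_apply]
    ring
  have hle : ∀ t ∈ Ico 0 T, 2 * ∑ i, (y t i - z t i) * (y' t i - z' t i) ≤
      1 * (∑ i, (y t i - z t i) ^ 2) + Fintype.card ι * δ ^ 2 := fun t ht => by
    have h1 : 2 * (δ * ∑ i, |y t i - z t i|) ≤ ∑ i, ((y t i - z t i) ^ 2 + δ ^ 2) := by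
      rw [Finset.mul_sum, Finset.mul_sum]
      refine Finset.sum_le_sum fun i _ => ?_
      nlinarith [sq_nonneg (|y t i - z t i| - δ), sq_abs (y t i - z t i)]
    rw [Finset.sum_add_distrib, Finset.sum_const, Finset.card_univ, nsmul_eq_mul] at h1
    have := hd t ht
    linarith
  intro t ht
  have := le_gronwallBound_of_liminf_deriv_right_le (δ := 0) (K := 1)
    (f' := fun t => 2 * ∑ i, (y t i - z t i) * (y' t i - z' t i))
    (ε := Fintype.card ι * δ ^ 2)
    (fun t ht => (hderiv t ht).continuousWithinAt)
    (fun t ht r hr => ((hderiv t (Ico_subset_Icc_self ht)).mono_of_mem_nhdsWithin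
      (Icc_mem_nhdsGE_of_mem ht)).liminf_right_slope_le hr)
    (by simp [h0]) hle t ht
  rw [gronwallBound_of_K_ne_0 one_ne_zero] at this
  simpa using this

variable {G : (ι → ℝ) → ι → ℝ} {L : ℝ} {x₀ : ι → ℝ}

/-- Solutions of a regularized equation. -/
theorem exists_approximate_solution (hG : Continuous G) (hL : ∀ u, ‖G u‖ ≤ L) (x₀ : ι → ℝ)
    {δ T : ℝ} (hδ : 0 < δ) (hT : 0 ≤ T) :
    ∃ (g : (ι → ℝ) → ι → ℝ) (y : ℝ → ι → ℝ), Continuous g ∧ (∀ u, ‖g u - G u‖ ≤ δ) ∧ y 0 = x₀ ∧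
      ∀ t ∈ Icc 0 T, HasDerivWithinAt y (g (y t)) (Icc 0 T) t := by
  obtain ⟨g, hg, hgG, -⟩ := hG.exists_contDiff_approx 1 (ε := fun _ => δ) continuous_const
    fun _ => hδ
  have hgG' : ∀ u, ‖g u - G u‖ ≤ δ := fun u => by
    rw [← dist_eq_norm]; exact (hgG u).le
  have hL0 : 0 ≤ L := (norm_nonneg _).trans (hL x₀)
  have hgL : ∀ u, ‖g u‖ ≤ L + δ := fun u => by
    calc ‖g u‖ = ‖G u + (g u - G u)‖ := by rw [add_sub_cancel]
      _ ≤ L + δ := (norm_add_le _ _).trans (add_le_add (hL u) (hgG' u))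
  obtain ⟨K, hK⟩ : ∃ K, LipschitzOnWith K g (Metric.closedBall x₀ ((L + δ) * T)) :=
    LocallyLipschitzOn.exists_lipschitzOnWith_of_compact (isCompact_closedBall _ _)
      hg.locallyLipschitz.locallyLipschitzOn
  -- The speed is at most `L + δ`, so a solution stays in the ball of radius `(L + δ) * T` up to
  -- time `T`.
  have hpl : IsPicardLindelof (fun _ => g) (⟨0, left_mem_Icc.2 hT⟩ : Icc (0 : ℝ) T) x₀
      ⟨(L + δ) * T, by positivity⟩ 0 ⟨L + δ, by positivity⟩ K :=
    IsPicardLindelof.of_time_independent (fun u _ => hgL u) hK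
      (by simp only [sub_zero, sub_self, max_eq_left hT]; simp only [NNReal.coe_zero, sub_zero]; exact le_rfl)
  obtain ⟨y, hy0, hy⟩ := hpl.exists_eq_forall_mem_Icc_hasDerivWithinAt₀
  exact ⟨g, y, hg.continuous, hgG', hy0, hy⟩

/-- A solution cannot cross a level at which the velocity is negative. -/
theorem le_of_deriv_neg_at_level {f f' : ℝ → ℝ} {T M : ℝ}
    (hf : ∀ t ∈ Icc 0 T, HasDerivWithinAt f (f' t) (Icc 0 T) t) (h0 : f 0 ≤ M)
    (hM : ∀ t ∈ Ico 0 T, f t = M → f' t < 0) : ∀ t ∈ Icc 0 T, f t ≤ M := by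
  intro t ht
  exact image_le_of_deriv_right_lt_deriv_boundary' (B := fun _ => M) (B' := fun _ => 0)
    (fun t ht => (hf t ht).continuousWithinAt)
    (fun t ht => (hf t (Ico_subset_Icc_self ht)).mono_of_mem_nhdsWithin
      (Icc_mem_nhdsGE_of_mem ht)) h0 continuousOn_const
    (fun t _ => hasDerivWithinAt_const _ _ _) hM ht

/-- Global existence for a bounded continuous vector field which is dissipative on a box that
solutions cannot leave. -/
theorem exists_solution_of_dissipative (hG : Continuous G) (hL : ∀ u, ‖G u‖ ≤ L)
    {P : ι → Prop} {M : ι → ℝ} {μ : ℝ} (hμ : 0 < μ)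
    (hbar : ∀ u i, P i → M i ≤ u i → G u i ≤ -μ)
    (hdiss : ∀ u v : ι → ℝ, (∀ i, P i → u i ≤ M i) → (∀ i, P i → v i ≤ M i) →
      ∑ i, (u i - v i) * (G u i - G v i) ≤ 0)
    (hx₀ : ∀ i, P i → x₀ i ≤ M i) :
    ∃ x : ℝ → ι → ℝ, x 0 = x₀ ∧ (∀ t, 0 ≤ t → ∀ i, P i → x t i ≤ M i) ∧
      ∀ t, 0 ≤ t → ∀ i, HasDerivWithinAt (fun s => x s i) (G (x t) i) (Ici 0) t := by
  -- An error of at most `μ / 2` keeps the regularized velocity negative at the walls of the box; an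
  -- error of at most `1` bounds all speeds by `L + 1`.
  set η : ℝ := min 1 (μ / 2) with hη
  have hη0 : 0 < η := by positivity
  set δ : ℕ → ℝ := fun m => η / (m + 1) with hδ
  have hδ0 : ∀ m, 0 < δ m := fun m => by positivity
  have hδη : ∀ m, δ m ≤ η := fun m => div_le_self hη0.le (by simp)
  have hδlim : Tendsto δ atTop (𝓝 0) := by
    simpa [hδ, div_eq_mul_inv] using
      (tendsto_one_div_add_atTop_nhds_zero_nat (𝕜 := ℝ)).const_mul η
  choose g y hg hgG hy0 hy using fun m : ℕ =>
    exists_approximate_solution hG hL x₀ (hδ0 m) (Nat.cast_nonneg m)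
  have hyi : ∀ m : ℕ, ∀ t ∈ Icc (0 : ℝ) m, ∀ i,
      HasDerivWithinAt (fun s => y m s i) (g m (y m t) i) (Icc 0 m) t := fun m t ht i =>
    hasDerivWithinAt_pi.1 (hy m t ht) i
  have hgGi : ∀ m u i, |g m u i - G u i| ≤ δ m := fun m u i =>
    (norm_le_pi_norm (g m u - G u) i).trans (hgG m u)
  have hbox : ∀ m : ℕ, ∀ t ∈ Icc (0 : ℝ) m, ∀ i, P i → y m t i ≤ M i := fun m t ht i hi => by
    refine le_of_deriv_neg_at_level (fun t ht => hyi m t ht i) (by simpa [hy0] using hx₀ i hi)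
      (fun s _ hs => ?_) t ht
    have h1 := hbar (y m s) i hi hs.ge
    have h2 := abs_le.1 (hgGi m (y m s) i)
    have h3 := hδη m
    have h4 : η ≤ μ / 2 := min_le_right _ _
    linarith
  -- Dissipativity of `G` leaves only the errors `δ m + δ n`, so no Lipschitz constant of the
  -- approximations enters. This gives the Cauchy property.
  have hclose : ∀ m n : ℕ, ∀ t : ℝ, 0 ≤ t → t ≤ m → t ≤ n →
      ∑ i, (y m t i - y n t i) ^ 2 ≤
        Fintype.card ι * (δ m + δ n) ^ 2 * (Real.exp t - 1) := fun m n t ht hm hn => by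
    have hsm : Icc 0 t ⊆ Icc (0 : ℝ) m := Icc_subset_Icc_right hm
    have hsn : Icc 0 t ⊆ Icc (0 : ℝ) n := Icc_subset_Icc_right hn
    refine sum_sq_sub_le_of_dissipative (I := Icc 0 t) Subset.rfl
      (fun s hs i => (hyi m s (hsm hs) i).mono hsm) (fun s hs i => (hyi n s (hsn hs) i).mono hsn)
      (by rw [hy0, hy0]) (fun s hs => ?_) t ⟨ht, le_rfl⟩
    have hs := Ico_subset_Icc_self hs
    have h1 := hdiss (y m s) (y n s) (hbox m s (hsm hs)) (hbox n s (hsn hs))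
    have h2 : ∀ i ∈ Finset.univ, (y m s i - y n s i) * (g m (y m s) i - g n (y n s) i) ≤
        (y m s i - y n s i) * (G (y m s) i - G (y n s) i) +
          (δ m + δ n) * |y m s i - y n s i| := fun i _ => by
      have e1 := hgGi m (y m s) i
      have e2 := hgGi n (y n s) i
      have e3 : |(g m (y m s) i - G (y m s) i) - (g n (y n s) i - G (y n s) i)| ≤ δ m + δ n :=
        (abs_sub _ _).trans (add_le_add e1 e2)
      have e4 := (le_abs_self _).trans (abs_mul (y m s i - y n s i)
        ((g m (y m s) i - G (y m s) i) - (g n (y n s) i - G (y n s) i))).le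
      have e5 := mul_le_mul_of_nonneg_left e3 (abs_nonneg (y m s i - y n s i))
      linarith
    have h3 := Finset.sum_le_sum h2
    rw [Finset.sum_add_distrib, ← Finset.mul_sum] at h3
    linarith
  have hcauchy : ∀ t, 0 ≤ t → ∀ i, ∃ a, Tendsto (fun m => y m t i) atTop (𝓝 a) := fun t ht i => by
    obtain ⟨k, hk⟩ := exists_nat_ge t
    set c := √(Fintype.card ι * Real.exp t) with hc
    have : CauchySeq fun m => y (m + k) t i := by
      refine cauchySeq_of_le_tendsto_0 (fun N => c * (2 * δ N)) (fun m n N hm hn => ?_)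
        (by simpa using (hδlim.const_mul 2).const_mul c)
      have hmk : t ≤ (m + k : ℕ) := by push_cast; linarith [(Nat.cast_nonneg m : (0 : ℝ) ≤ m)]
      have hnk : t ≤ (n + k : ℕ) := by push_cast; linarith [(Nat.cast_nonneg n : (0 : ℝ) ≤ n)]
      have h1 := hclose _ _ t ht hmk hnk
      have hmono : ∀ p, N ≤ p → δ (p + k) ≤ δ N := fun p hp => by
        refine div_le_div_of_nonneg_left hη0.le (by positivity) ?_
        have : (N : ℝ) ≤ p := by exact_mod_cast hp
        push_cast
        linarith [(Nat.cast_nonneg k : (0 : ℝ) ≤ k)]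
      have h2 : δ (m + k) + δ (n + k) ≤ 2 * δ N := by linarith [hmono m hm, hmono n hn]
      have h3 := Finset.single_le_sum (f := fun i => (y (m + k) t i - y (n + k) t i) ^ 2)
        (fun i _ => sq_nonneg _) (Finset.mem_univ i)
      rw [Real.dist_eq]
      refine abs_le_of_sq_le_sq (h3.trans (h1.trans ?_)) (by positivity)
      rw [mul_pow, hc, Real.sq_sqrt (by positivity)]
      have h4 : (δ (m + k) + δ (n + k)) ^ 2 ≤ (2 * δ N) ^ 2 :=
        pow_le_pow_left₀ (add_pos (hδ0 _) (hδ0 _)).le h2 2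
      have h5 : Real.exp t - 1 ≤ Real.exp t := by linarith
      have h6 : 0 ≤ Real.exp t - 1 := by linarith [Real.one_le_exp ht]
      calc _ ≤ Fintype.card ι * (2 * δ N) ^ 2 * Real.exp t := by gcongr
        _ = _ := by ring
    obtain ⟨a, ha⟩ := cauchySeq_tendsto_of_complete this
    exact ⟨a, (tendsto_add_atTop_iff_nat (f := fun m => y m t i) k).1 ha⟩
  choose! x hx using hcauchy
  have hx' : ∀ t, 0 ≤ t → Tendsto (fun m => y m t) atTop (𝓝 (x t)) := fun t ht =>
    tendsto_pi_nhds.2 fun i => hx t ht i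
  have hgL : ∀ m u i, |g m u i| ≤ L + 1 := fun m u i => by
    have h1 := hgGi m u i
    have h2 := (norm_le_pi_norm (G u) i).trans (hL u)
    have h3 := (hδη m).trans (min_le_left _ _)
    rw [Real.norm_eq_abs] at h2
    rw [abs_le] at *
    constructor <;> linarith
  have hL1 : 0 ≤ L + 1 := by linarith [(norm_nonneg (G x₀)).trans (hL x₀)]
  have hlip : ∀ i, ∀ s, 0 ≤ s → ∀ t, 0 ≤ t → |x t i - x s i| ≤ (L + 1) * |t - s| :=
      fun i s hs t ht => by
    refine le_of_tendsto ((hx t ht i).sub (hx s hs i)).abs ?_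
    filter_upwards [eventually_ge_atTop ⌈s⌉₊, eventually_ge_atTop ⌈t⌉₊] with m h1 h2
    exact (convex_Icc (0 : ℝ) m).norm_image_sub_le_of_norm_hasDerivWithin_le
      (fun r hr => hyi m r hr i) (fun r _ => hgL m _ i) ⟨hs, Nat.ceil_le.1 h1⟩
      ⟨ht, Nat.ceil_le.1 h2⟩
  -- Freezing `x` at negative times makes the integrand continuous on the whole line, so the
  -- two-sided fundamental theorem applies at `0` too.
  have hcont : Continuous fun s => x (max s 0) := by
    refine continuous_pi fun i => ?_
    refine (LipschitzWith.of_dist_le_mul (K := ⟨L + 1, hL1⟩) fun t s => ?_).continuous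
    rw [Real.dist_eq, Real.dist_eq]
    refine (hlip i _ (le_max_right _ _) _ (le_max_right _ _)).trans ?_
    exact mul_le_mul_of_nonneg_left (abs_max_sub_max_le_abs t s 0) hL1
  have hint : ∀ i, ∀ t, 0 ≤ t → x t i = x₀ i + ∫ s in (0 : ℝ)..t, G (x (max s 0)) i :=
      fun i t ht => by
    have h1 : Tendsto (fun m => ∫ s in (0 : ℝ)..t, g m (y m s) i) atTop
        (𝓝 (∫ s in (0 : ℝ)..t, G (x (max s 0)) i)) := by
      refine intervalIntegral.tendsto_integral_filter_of_dominated_convergence (fun _ => L + 1)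
        ?_ ?_ intervalIntegrable_const ?_
      · filter_upwards [eventually_ge_atTop ⌈t⌉₊] with m hm
        rw [uIoc_of_le ht]
        refine ContinuousOn.aestronglyMeasurable (fun s hs => ?_) measurableSet_Ioc
        have hs' : s ∈ Icc (0 : ℝ) m := ⟨hs.1.le, hs.2.trans (Nat.ceil_le.1 hm)⟩
        have h2 : ContinuousWithinAt (y m) (Icc 0 m) s := (hy m s hs').continuousWithinAt
        exact ((((continuous_apply i).comp (hg m)).continuousAt.comp_continuousWithinAt h2)).mono
          fun r hr => ⟨hr.1.le, hr.2.trans (Nat.ceil_le.1 hm)⟩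
      · exact Eventually.of_forall fun m => Eventually.of_forall fun s _ => hgL m _ i
      · refine Eventually.of_forall fun s hs => ?_
        rw [uIoc_of_le ht] at hs
        rw [max_eq_left hs.1.le]
        have h2 : Tendsto (fun m => G (y m s) i) atTop (𝓝 (G (x s) i)) :=
          (((continuous_apply i).comp hG).tendsto (x s)).comp (hx' s hs.1.le)
        have h3 : Tendsto (fun m => g m (y m s) i - G (y m s) i) atTop (𝓝 0) :=
          squeeze_zero_norm (fun m => hgGi m _ i) hδlim
        simpa using h3.add h2
    have h2 : Tendsto (fun m => y m t i) atTop
        (𝓝 (x₀ i + ∫ s in (0 : ℝ)..t, G (x (max s 0)) i)) := by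
      refine (h1.const_add (x₀ i)).congr' ?_
      filter_upwards [eventually_ge_atTop ⌈t⌉₊] with m hm
      have htm : t ≤ m := Nat.ceil_le.1 hm
      have hsub : Icc 0 t ⊆ Icc (0 : ℝ) m := Icc_subset_Icc_right htm
      have hc : ContinuousOn (y m) (Icc 0 t) := fun s hs =>
        (hy m s (hsub hs)).continuousWithinAt.mono hsub
      have hci : ContinuousOn (fun s => g m (y m s) i) (Icc 0 t) :=
        ((continuous_apply i).comp (hg m)).comp_continuousOn hc
      rw [intervalIntegral.integral_eq_sub_of_hasDerivAt_of_le ht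
        (f := fun s => y m s i) ((continuous_apply i).comp_continuousOn hc)
        (fun s hs => (hyi m s (hsub (Ioo_subset_Icc_self hs)) i).hasDerivAt
          (Icc_mem_nhds hs.1 (hs.2.trans_le htm)))
        (hci.intervalIntegrable_of_Icc ht), hy0]
      ring
    exact tendsto_nhds_unique (hx t ht i) h2
  refine ⟨x, ?_, fun t ht i hi => ?_, fun t ht i => ?_⟩
  · ext i
    simpa using hint i 0 le_rfl
  · refine le_of_tendsto (hx t ht i) ?_
    filter_upwards [eventually_ge_atTop ⌈t⌉₊] with m hm
    exact hbox m t ⟨ht, Nat.ceil_le.1 hm⟩ i hi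
  · have hφ : Continuous fun s => G (x (max s 0)) i :=
      (continuous_apply i).comp (hG.comp hcont)
    have hd : HasDerivAt (fun t => x₀ i + ∫ s in (0 : ℝ)..t, G (x (max s 0)) i)
        (G (x (max t 0)) i) t :=
      (intervalIntegral.integral_hasDerivAt_right (hφ.intervalIntegrable _ _)
        (hφ.stronglyMeasurableAtFilter _ _) hφ.continuousAt).const_add _
    rw [max_eq_left ht] at hd
    exact hd.hasDerivWithinAt.congr (fun s hs => hint i s hs) (hint i t ht)

end ODE

end DiscreteConformal

namespace DiscreteConformal

open Set Filter Topology

/-! ### Coercivity and exponential decay -/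

section Exponential

theorem le_mul_exp_of_deriv_le {E E' : ℝ → ℝ} {b : ℝ}
    (hE : ∀ t, 0 ≤ t → HasDerivWithinAt E (E' t) (Ici 0) t) (h : ∀ t, 0 ≤ t → E' t ≤ -b * E t)
    {t : ℝ} (ht : 0 ≤ t) : E t ≤ E 0 * Real.exp (-b * t) := by
  have hd : ∀ t, 0 ≤ t → HasDerivWithinAt (fun s => E s * Real.exp (b * s))
      (E' t * Real.exp (b * t) + E t * (Real.exp (b * t) * b)) (Ici 0) t := fun t ht => by
    have h1 : HasDerivAt (fun s : ℝ => Real.exp (b * s)) (Real.exp (b * t) * b) t := by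
      simpa using ((hasDerivAt_id t).const_mul b).exp
    exact (hE t ht).mul h1.hasDerivWithinAt
  have hanti : AntitoneOn (fun s => E s * Real.exp (b * s)) (Ici 0) := by
    refine antitoneOn_of_deriv_nonpos (convex_Ici _) (fun t ht => (hd t ht).continuousWithinAt)
      ?_ ?_ <;> rw [interior_Ici]
    · intro t ht
      exact ((hd t (le_of_lt ht)).mono Ioi_subset_Ici_self).differentiableWithinAt
    · intro t ht
      rw [((hd t (le_of_lt ht)).hasDerivAt (Ici_mem_nhds ht)).deriv]
      nlinarith [h t (le_of_lt ht), Real.exp_pos (b * t)]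
  have := hanti self_mem_Ici ht ht
  simp only [mul_zero, Real.exp_zero, mul_one] at this
  calc E t = E t * Real.exp (b * t) * Real.exp (-b * t) := by
        rw [mul_assoc, ← Real.exp_add]; simp
    _ ≤ _ := mul_le_mul_of_nonneg_right this (Real.exp_pos _).le

variable {ι : Type*} [Fintype ι]

/-- A monotone map with positive definite derivative at a point is coercive at this point on
bounded sets. -/
theorem exists_coercive {D : Set (ι → ℝ)} (hD : Convex ℝ D) {k : (ι → ℝ) → ι → ℝ} {p : ι → ℝ}
    (hp : p ∈ D) (mono : ∀ u ∈ D, ∀ v ∈ D, 0 ≤ ∑ i, (u i - v i) * (k u i - k v i))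
    {k' : (ι → ℝ) →L[ℝ] (ι → ℝ)} (hk : HasFDerivAt k k' p)
    (hpos : ∀ w : ι → ℝ, w ≠ 0 → 0 < ∑ i, w i * k' w i) {R : ℝ} (hR : 0 ≤ R) :
    ∃ a > 0, ∀ u ∈ D, ‖u - p‖ ≤ R →
      a * ∑ i, (u i - p i) ^ 2 ≤ ∑ i, (u i - p i) * (k u i - k p i) := by
  set n : ℝ := (Fintype.card ι : ℝ) with hn
  have hn0 : 0 ≤ n := by positivity
  -- The minimum of the form on the unit sphere, which is empty when `ι` is.
  obtain ⟨δ, hδ, hδw⟩ : ∃ δ > 0, ∀ w : ι → ℝ, δ * ‖w‖ ^ 2 ≤ ∑ i, w i * k' w i := by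
    rcases (Metric.sphere (0 : ι → ℝ) 1).eq_empty_or_nonempty with hemp | hne
    · refine ⟨1, one_pos, fun w => ?_⟩
      by_cases hw : w = 0
      · simp [hw]
      · exact absurd (show ‖w‖⁻¹ • w ∈ Metric.sphere (0 : ι → ℝ) 1 by simp [norm_smul, hw])
          (by simp [hemp])
    · obtain ⟨w₀, hw₀, hmin⟩ := (isCompact_sphere (0 : ι → ℝ) 1).exists_isMinOn hne
        (f := fun w => ∑ i, w i * k' w i) (by fun_prop)
      have h0 : w₀ ≠ 0 := by rintro rfl; simp at hw₀
      refine ⟨_, hpos w₀ h0, fun w => ?_⟩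
      by_cases hw : w = 0
      · simp [hw]
      have h1 : ∑ i, w₀ i * k' w₀ i ≤ ∑ i, (‖w‖⁻¹ • w) i * k' (‖w‖⁻¹ • w) i :=
        hmin (show ‖w‖⁻¹ • w ∈ Metric.sphere (0 : ι → ℝ) 1 by simp [norm_smul, hw])
      have h2 : ∑ i, (‖w‖⁻¹ • w) i * k' (‖w‖⁻¹ • w) i =
          (‖w‖⁻¹) ^ 2 * ∑ i, w i * k' w i := by
        rw [Finset.mul_sum]
        refine Finset.sum_congr rfl fun i _ => ?_
        simp only [map_smul, Pi.smul_apply, smul_eq_mul]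
        ring
      rw [h2] at h1
      have h3 : 0 < ‖w‖ := norm_pos_iff.2 hw
      calc _ ≤ (‖w‖⁻¹) ^ 2 * (∑ i, w i * k' w i) * ‖w‖ ^ 2 := by gcongr
        _ = _ := by field_simp
  -- The linearization error, summed over the `n` coordinates, uses up at most half of the lower
  -- bound `δ`.
  set c : ℝ := δ / (2 * (n + 1)) with hc
  have hc0 : 0 < c := by positivity
  have hnc : n * c ≤ δ / 2 := by
    rw [hc]
    have : n / (n + 1) ≤ 1 := div_le_one_of_le₀ (by linarith) (by linarith)
    calc n * (δ / (2 * (n + 1))) = δ / 2 * (n / (n + 1)) := by field_simp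
      _ ≤ _ := mul_le_of_le_one_right (by positivity) this
  obtain ⟨r, hr, hball⟩ := Metric.eventually_nhds_iff.1 (hk.isLittleO.def hc0)
  have hloc : ∀ v, ‖v - p‖ < r →
      δ / 2 * ‖v - p‖ ^ 2 ≤ ∑ i, (v i - p i) * (k v i - k p i) := fun v hv => by
    have h1 := hball (y := v) (by rwa [dist_eq_norm])
    have h2 : ∀ i ∈ Finset.univ, (v - p) i * k' (v - p) i - c * ‖v - p‖ ^ 2 ≤
        (v i - p i) * (k v i - k p i) := fun i _ => by
      have e1 : |k v i - k p i - k' (v - p) i| ≤ c * ‖v - p‖ :=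
        (norm_le_pi_norm (k v - k p - k' (v - p)) i).trans h1
      have e2 : |v i - p i| ≤ ‖v - p‖ := norm_le_pi_norm (v - p) i
      have e3 : |(v i - p i) * (k v i - k p i - k' (v - p) i)| ≤ ‖v - p‖ * (c * ‖v - p‖) := by
        rw [abs_mul]
        exact mul_le_mul e2 e1 (abs_nonneg _) (norm_nonneg _)
      have e4 := neg_le_of_abs_le e3
      simp only [Pi.sub_apply] at *
      linarith
    have h3 := Finset.sum_le_sum h2
    rw [Finset.sum_sub_distrib, Finset.sum_const, Finset.card_univ, nsmul_eq_mul] at h3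
    have h4 := hδw (v - p)
    have h5 := mul_le_mul_of_nonneg_right hnc (sq_nonneg ‖v - p‖)
    linarith
  -- Shrinking towards `p` by `s` maps the ball of radius `R` into the one of radius `r`, where
  -- linearization works. Monotonicity between `u` and the shrunken point `v` carries the bound at
  -- `v` over to `u`.
  set s : ℝ := r / (2 * (R + r)) with hs
  have hs0 : 0 < s := by positivity
  have hs1 : s ≤ 1 / 2 := by
    rw [hs, div_le_div_iff₀ (by positivity) (by positivity)]; linarith
  have hsR : s * R < r := by
    rw [hs, div_mul_eq_mul_div, div_lt_iff₀ (by positivity)]; nlinarith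
  refine ⟨δ * s / (2 * (n + 1)), by positivity, fun u hu huR => ?_⟩
  set v : ι → ℝ := p + s • (u - p) with hv
  have hvD : v ∈ D := hD.add_smul_sub_mem hp hu ⟨hs0.le, by linarith⟩
  have hvi : ∀ i, v i - p i = s * (u i - p i) := fun i => by simp [hv]
  have hvn : ‖v - p‖ = s * ‖u - p‖ := by
    rw [hv, add_sub_cancel_left, norm_smul, Real.norm_of_nonneg hs0.le]
  have h1 := hloc v (by
    rw [hvn]; exact (mul_le_mul_of_nonneg_left huR hs0.le).trans_lt hsR)
  rw [hvn] at h1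
  simp only [hvi, mul_assoc] at h1
  rw [← Finset.mul_sum] at h1
  have h2 : 0 ≤ (1 - s) * ∑ i, (u i - p i) * (k u i - k v i) := by
    refine (mono u hu v hvD).trans_eq ?_
    rw [Finset.mul_sum]
    refine Finset.sum_congr rfl fun i _ => ?_
    rw [show u i - v i = (1 - s) * (u i - p i) by linarith [hvi i]]
    ring
  have h3 : 0 ≤ ∑ i, (u i - p i) * (k u i - k v i) :=
    nonneg_of_mul_nonneg_right h2 (by linarith)
  have h4 : ∑ i, (u i - p i) * (k u i - k p i) = ∑ i, (u i - p i) * (k u i - k v i) +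
      ∑ i, (u i - p i) * (k v i - k p i) := by
    rw [← Finset.sum_add_distrib]
    exact Finset.sum_congr rfl fun i _ => by ring
  have h5 : δ / 2 * s * ‖u - p‖ ^ 2 ≤ ∑ i, (u i - p i) * (k v i - k p i) := by
    refine le_of_mul_le_mul_left ?_ hs0
    linarith
  have h6 : ∑ i, (u i - p i) ^ 2 ≤ (n + 1) * ‖u - p‖ ^ 2 := by
    have : ∀ i ∈ Finset.univ, (u i - p i) ^ 2 ≤ ‖u - p‖ ^ 2 := fun i _ => by
      rw [← sq_abs]
      exact pow_le_pow_left₀ (abs_nonneg _) (norm_le_pi_norm (u - p) i) 2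
    have := Finset.sum_le_sum this
    rw [Finset.sum_const, Finset.card_univ, nsmul_eq_mul] at this
    nlinarith [sq_nonneg ‖u - p‖]
  calc _ ≤ δ * s / (2 * (n + 1)) * ((n + 1) * ‖u - p‖ ^ 2) := by gcongr
    _ = δ / 2 * s * ‖u - p‖ ^ 2 := by field_simp
    _ ≤ _ := by linarith

end Exponential

/-! ### Angles near the boundary `u = 0` -/

section Barrier

open Real

theorem sCoord_le_cCoord {e u : ℝ} (hu : e = 1 → u < 0) (he : e = 1) : sCoord e u ≤ cCoord e u := by
  refine abs_le_of_sq_le_sq' ?_ (cCoord_pos hu (Or.inr he)).le |>.2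
  rw [cCoord_sq hu (Or.inr he), he]
  linarith

/-- Since `S₂ ≤ C₂`, the cosh is at least `S₂ * (C₁ + h * S₁)`. The second factor is comparable to
`C₁ + S₁`, as `h > 0` when `e₁ = 0`, while `h > -1` and `S₁ ≤ C₁` when `e₁ = 1`. -/
theorem exists_le_coshSide {e₁ e₂ h : ℝ} (he₁ : e₁ = 0 ∨ e₁ = 1) (he₂ : e₂ = 1)
    (hh : 0 < e₁ * e₂ + h) : ∃ m > 0, ∀ u₁ u₂ : ℝ, (e₁ = 1 → u₁ < 0) → (e₂ = 1 → u₂ < 0) →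
      m * sCoord e₂ u₂ * (cCoord e₁ u₁ + sCoord e₁ u₁) ≤ coshSide e₁ e₂ h u₁ u₂ := by
  obtain ⟨m, hm, hmu⟩ : ∃ m > 0, ∀ u₁ : ℝ, (e₁ = 1 → u₁ < 0) →
      m * (cCoord e₁ u₁ + sCoord e₁ u₁) ≤ cCoord e₁ u₁ + h * sCoord e₁ u₁ := by
    rcases he₁ with rfl | h1
    · have h0 : 0 < h := by linarith
      refine ⟨min 1 h, by positivity, fun u₁ hu₁ => ?_⟩
      have := sCoord_pos hu₁ (Or.inl rfl)
      have := cCoord_pos hu₁ (Or.inl rfl)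
      nlinarith [min_le_left 1 h, min_le_right 1 h]
    · have h0 : 0 < 1 + h := by subst h1 he₂; linarith
      rcases le_total 1 h with h2 | h2
      · refine ⟨1, one_pos, fun u₁ hu₁ => ?_⟩
        have := sCoord_pos hu₁ (Or.inr h1)
        nlinarith
      · refine ⟨(1 + h) / 2, by positivity, fun u₁ hu₁ => ?_⟩
        have := sCoord_le_cCoord hu₁ h1
        nlinarith
  refine ⟨m, hm, fun u₁ u₂ hu₁ hu₂ => ?_⟩
  have h1 := sCoord_le_cCoord hu₂ he₂
  have h2 := cCoord_pos hu₁ he₁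
  have h3 := mul_le_mul_of_nonneg_left (hmu u₁ hu₁) (sCoord_pos hu₂ (Or.inr he₂)).le
  have h4 := mul_le_mul_of_nonneg_left h1 h2.le
  unfold coshSide
  linarith

theorem coshSide_comm (e₁ e₂ h u₁ u₂ : ℝ) : coshSide e₁ e₂ h u₁ u₂ = coshSide e₂ e₁ h u₂ u₁ := by
  unfold coshSide; ring

theorem coshSide_le {e₁ e₂ h u₁ u₂ : ℝ} (he₁ : e₁ = 0 ∨ e₁ = 1) (he₂ : e₂ = 0 ∨ e₂ = 1)
    (hu₁ : e₁ = 1 → u₁ < 0) (hu₂ : e₂ = 1 → u₂ < 0) : coshSide e₁ e₂ h u₁ u₂ ≤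
      (1 + |h|) * ((cCoord e₁ u₁ + sCoord e₁ u₁) * (cCoord e₂ u₂ + sCoord e₂ u₂)) := by
  have s₁ := sCoord_pos hu₁ he₁
  have s₂ := sCoord_pos hu₂ he₂
  have c₁ := cCoord_pos hu₁ he₁
  have c₂ := cCoord_pos hu₂ he₂
  unfold coshSide
  generalize sCoord e₁ u₁ = S₁ at *
  generalize sCoord e₂ u₂ = S₂ at *
  generalize cCoord e₁ u₁ = C₁ at *
  generalize cCoord e₂ u₂ = C₂ at *
  have h1 := mul_le_mul_of_nonneg_right (le_abs_self h) (mul_pos s₁ s₂).le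
  have h2 : 0 ≤ |h| * (C₁ * C₂ + C₁ * S₂ + S₁ * C₂) + (C₁ * S₂ + S₁ * C₂ + S₁ * S₂) := by
    positivity
  linarith

theorem exists_le_sCoord_sq (Q : ℝ) :
    ∃ c < 0, ∀ u < 0, c ≤ u → Q ≤ sCoord 1 u ^ 2 := by
  set q := max 1 Q with hq
  have hq0 : 0 < √q := sqrt_pos.2 (by positivity)
  refine ⟨-arsinh (√q)⁻¹, by simpa using hq0, fun u hu hcu => ?_⟩
  have hs : 0 < sinh (-u) := sinh_pos_iff.2 (by linarith)
  have h1 : sinh (-u) ≤ (√q)⁻¹ := by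
    rw [← sinh_arsinh (√q)⁻¹, sinh_le_sinh]; linarith
  have h2 : √q ≤ sCoord 1 u := by
    simp only [sCoord, one_ne_zero, if_false]
    exact (le_inv_comm₀ hs hq0).1 h1
  calc Q ≤ q := le_max_right _ _
    _ = √q ^ 2 := (sq_sqrt (by positivity)).symm
    _ ≤ _ := pow_le_pow_left₀ hq0.le h2 2

/-- The roots are at most `y` and `z`. Capping `δ` at `π / 2` makes its cosine nonnegative, so
enlarging the denominator to `y * z` is harmless. -/
theorem arccos_cornerCos_le {x y z δ : ℝ} (hy : 1 < y) (hz : 1 < z) (hδ : 0 < δ)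
    (hx : x ≤ (1 - cos (min δ (π / 2))) * (y * z)) : arccos (cornerCos x y z) ≤ δ := by
  have k2 : 0 < y ^ 2 - 1 := by nlinarith
  have k3 : 0 < z ^ 2 - 1 := by nlinarith
  have hp : 0 < √(y ^ 2 - 1) := sqrt_pos.2 k2
  have hq : 0 < √(z ^ 2 - 1) := sqrt_pos.2 k3
  have hp' : √(y ^ 2 - 1) ≤ y := sqrt_le_iff.2 ⟨by linarith, by linarith⟩
  have hq' : √(z ^ 2 - 1) ≤ z := sqrt_le_iff.2 ⟨by linarith, by linarith⟩
  set δ' := min δ (π / 2) with hδ'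
  have h0 : 0 < δ' := by have := pi_pos; positivity
  have h1 : δ' ≤ π / 2 := min_le_right _ _
  have hcos : 0 ≤ cos δ' := cos_nonneg_of_neg_pi_div_two_le_of_le (by linarith) h1
  have hle : cos δ' ≤ cornerCos x y z := by
    unfold cornerCos
    rw [le_div_iff₀ (by positivity)]
    have := mul_le_mul_of_nonneg_left (mul_le_mul hp' hq' hq.le (by linarith)) hcos
    linarith
  calc arccos (cornerCos x y z) ≤ arccos (cos δ') := antitone_arccos hle
    _ = δ' := arccos_cos h0.le (by linarith)
    _ ≤ δ := min_le_left _ _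

/-- The angle at a vertex of weight one becomes uniformly small when its coordinate tends to
zero. -/
theorem IsStructure.eventually_triAngle_le {e h : Fin 3 → ℝ} (H : IsStructure e h) {k : Fin 3}
    (hk : e k = 1) {δ : ℝ} (hδ : 0 < δ) :
    ∀ᶠ c in 𝓝[<] (0 : ℝ), ∀ u ∈ admissible e, c ≤ u k → triAngle e h u k ≤ δ := by
  have k1 : k + 1 + 2 = k := by fin_cases k <;> rfl
  have k2 : k + 2 + 1 = k := by fin_cases k <;> rfl
  have k3 : k + 1 + 1 = k + 2 := by fin_cases k <;> rfl
  have k4 : k + 2 + 2 = k + 1 := by fin_cases k <;> rfl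
  have E1 := H.edge (k + 1)
  have E2 := H.edge (k + 2)
  rw [k1, k3] at E1
  rw [k2, k4, mul_comm (e k)] at E2
  obtain ⟨m₁, hm₁, H₁⟩ := exists_le_coshSide (H.weight (k + 2)) hk E1
  obtain ⟨m₂, hm₂, H₂⟩ := exists_le_coshSide (H.weight (k + 1)) hk E2
  set κ := 1 - cos (min δ (π / 2)) with hκ
  have hκ0 : 0 < κ := by
    have h0 : 0 < min δ (π / 2) := by have := pi_pos; positivity
    have h1 : min δ (π / 2) ≤ π / 2 := min_le_right _ _
    have := cos_lt_cos_of_nonneg_of_le_pi le_rfl (by linarith [pi_pos]) h0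
    rw [cos_zero] at this
    linarith
  -- The opposite cosh is at most `(1 + |h k|) * (X * Y)`, while the product of the adjacent ones is
  -- at least `m₁ * m₂ * S ^ 2 * (X * Y)`, with `S` the value of `sCoord` at `k`. The factor `X * Y`
  -- cancels, which gives uniformity in the other coordinates.
  obtain ⟨c₀, hc₀, hS⟩ := exists_le_sCoord_sq ((1 + |h k|) / (m₁ * m₂ * κ))
  filter_upwards [Ioo_mem_nhdsLT hc₀] with c hc u hu hcu
  have s : (1 + |h k|) / (m₁ * m₂ * κ) ≤ sCoord (e k) (u k) ^ 2 := by
    rw [hk]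
    exact hS (u k) (hu k hk) (hc.1.le.trans hcu)
  rw [div_le_iff₀ (by positivity)] at s
  refine arccos_cornerCos_le (H.one_lt_triSide hu _) (H.one_lt_triSide hu _) hδ ?_
  have g0 : triSide e h u k ≤ _ :=
    coshSide_le (h := h k) (H.weight (k + 1)) (H.weight (k + 2)) (hu _) (hu _)
  have g1 := H₁ (u (k + 2)) (u k) (hu _) (hu _)
  have g2 := H₂ (u (k + 1)) (u k) (hu _) (hu _)
  have e1 : triSide e h u (k + 1) = coshSide (e (k + 2)) (e k) (h (k + 1)) (u (k + 2)) (u k) := by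
    unfold triSide; rw [k1, k3]
  have e2 : triSide e h u (k + 2) = coshSide (e (k + 1)) (e k) (h (k + 2)) (u (k + 1)) (u k) := by
    unfold triSide; rw [k2, k4, coshSide_comm]
  rw [e1, e2]
  have hX := add_pos (cCoord_pos (hu (k + 1)) (H.weight _)) (sCoord_pos (hu (k + 1)) (H.weight _))
  have hY := add_pos (cCoord_pos (hu (k + 2)) (H.weight _)) (sCoord_pos (hu (k + 2)) (H.weight _))
  have hSk := sCoord_pos (hu k) (H.weight k)
  set X := cCoord (e (k + 1)) (u (k + 1)) + sCoord (e (k + 1)) (u (k + 1))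
  set Y := cCoord (e (k + 2)) (u (k + 2)) + sCoord (e (k + 2)) (u (k + 2))
  have g3 := (by positivity : 0 ≤ m₁ * sCoord (e k) (u k) * Y).trans g1
  calc triSide e h u k ≤ (1 + |h k|) * (X * Y) := g0
    _ ≤ sCoord (e k) (u k) ^ 2 * (m₁ * m₂ * κ) * (X * Y) := by gcongr
    _ = κ * ((m₁ * sCoord (e k) (u k) * Y) * (m₂ * sCoord (e k) (u k) * X)) := by ring
    _ ≤ _ := by gcongr

end Barrier

end DiscreteConformal

namespace DiscreteConformal

open Set Filter Topology Real

/-! ### Angles and Gram determinant in terms of side lengths -/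

section Lengths

variable {a b c : ℝ}

theorem arccos_eq_pi_of_add_le (hb : 0 < b) (hc : 0 < c) (h : b + c ≤ a) :
    arccos ((cosh b * cosh c - cosh a) / (sinh b * sinh c)) = π := by
  rw [arccos_eq_pi, div_le_iff₀ (mul_pos (sinh_pos_iff.2 hb) (sinh_pos_iff.2 hc))]
  have : cosh (b + c) ≤ cosh a := by
    rw [cosh_le_cosh, abs_of_pos (by linarith), abs_of_pos (by linarith)]
    exact h
  rw [cosh_add] at this
  linarith

theorem arccos_eq_zero_of_le_abs_sub (ha : 0 < a) (hb : 0 < b) (hc : 0 < c) (h : a ≤ |b - c|) :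
    arccos ((cosh b * cosh c - cosh a) / (sinh b * sinh c)) = 0 := by
  refine arccos_of_one_le ?_
  rw [le_div_iff₀ (mul_pos (sinh_pos_iff.2 hb) (sinh_pos_iff.2 hc))]
  have : cosh a ≤ cosh (b - c) := by
    rwa [cosh_le_cosh, abs_of_pos ha]
  rw [cosh_sub] at this
  linarith

/-- The determinant factors as `(cosh (b + c) - cosh a) * (cosh a - cosh (b - c))`. -/
theorem gramDet_cosh_pos (ha : 0 < a) (hb : 0 < b) (hc : 0 < c) (h1 : a < b + c) (h2 : b < c + a)
    (h3 : c < a + b) : 0 < gramDet (cosh a) (cosh b) (cosh c) := by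
  have k1 : cosh a < cosh (b + c) := by
    rw [cosh_lt_cosh, abs_of_pos ha, abs_of_pos (by linarith)]
    exact h1
  have k2 : cosh (b - c) < cosh a := by
    rw [cosh_lt_cosh, abs_of_pos ha, abs_lt]
    constructor <;> linarith
  rw [cosh_add] at k1
  rw [cosh_sub] at k2
  have : gramDet (cosh a) (cosh b) (cosh c) =
      (cosh b * cosh c + sinh b * sinh c - cosh a) *
        (cosh a - (cosh b * cosh c - sinh b * sinh c)) := by
    unfold gramDet
    have e1 := cosh_sq b
    have e2 := cosh_sq c
    linear_combination (-1 + cosh c ^ 2) * e1 + sinh b ^ 2 * e2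
  rw [this]
  exact mul_pos (by linarith) (by linarith)

theorem arccos_cornerCos_arcosh {x y z : ℝ} (hx : 1 < x) (hy : 1 < y) (hz : 1 < z) :
    arccos ((cosh (arcosh y) * cosh (arcosh z) - cosh (arcosh x)) /
      (sinh (arcosh y) * sinh (arcosh z))) = arccos (cornerCos x y z) := by
  rw [cosh_arcosh hx.le, cosh_arcosh hy.le, cosh_arcosh hz.le, sinh_arcosh hy.le,
    sinh_arcosh hz.le]
  rfl

end Lengths

namespace Triangulation

/-! ### The change of coordinates from `f` to `u` -/

section CoordinateChange

variable {e f u : ℝ}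

theorem uCoord_eq_log (he : e = 1) : uCoord e f =
    1 / 2 * log ((√(1 + exp (2 * f)) - 1) / (√(1 + exp (2 * f)) + 1)) := by
  have h1 : 1 < √(1 + exp (2 * f)) := by
    rw [lt_sqrt (by norm_num)]; linarith [exp_pos (2 * f)]
  simp only [uCoord, he, one_ne_zero, if_false, one_mul]
  rw [abs_of_pos (div_pos (by linarith) (by linarith))]

theorem exp_two_mul_uCoord (he : e = 1) : exp (2 * uCoord e f) =
    (√(1 + exp (2 * f)) - 1) / (√(1 + exp (2 * f)) + 1) := by
  have h1 : 1 < √(1 + exp (2 * f)) := by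
    rw [lt_sqrt (by norm_num)]; linarith [exp_pos (2 * f)]
  rw [uCoord_eq_log he, ← mul_assoc, show (2 : ℝ) * (1 / 2) = 1 by norm_num, one_mul, exp_log]
  exact div_pos (by linarith) (by linarith)

theorem uCoord_neg (he : e = 1) : uCoord e f < 0 := by
  have h1 : 1 < √(1 + exp (2 * f)) := by
    rw [lt_sqrt (by norm_num)]; linarith [exp_pos (2 * f)]
  have h2 : exp (2 * uCoord e f) < 1 := by
    rw [exp_two_mul_uCoord he, div_lt_one (by linarith)]; linarith
  rw [exp_lt_one_iff] at h2
  linarith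

/-- For weight one, `exp (2 * u) = (r - 1) / (r + 1)` with `r = √(1 + exp (2 * f))`, that is, `r =
coth (-u)`. -/
theorem cCoord_uCoord (he : e = 0 ∨ e = 1) : cCoord e (uCoord e f) = √(1 + e * exp (2 * f)) := by
  rcases he with rfl | rfl
  · simp [cCoord]
  · have h1 : 1 < √(1 + exp (2 * f)) := by
      rw [lt_sqrt (by norm_num)]; linarith [exp_pos (2 * f)]
    have h2 := exp_two_mul_uCoord (e := 1) (f := f) rfl
    have h3 := uCoord_neg (e := 1) (f := f) rfl
    have hs : 0 < sinh (-uCoord 1 f) := sinh_pos_iff.2 (by linarith)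
    have h4 : exp (uCoord 1 f) * exp (uCoord 1 f) = exp (2 * uCoord 1 f) := by
      rw [← exp_add]; ring_nf
    rw [h2, eq_div_iff (by linarith)] at h4
    have h5 : exp (-uCoord 1 f) * exp (uCoord 1 f) = 1 := by rw [← exp_add]; simp
    simp only [cCoord, one_ne_zero, if_false, one_mul]
    rw [div_eq_iff hs.ne', cosh_eq, sinh_eq, neg_neg]
    generalize √(1 + exp (2 * f)) = r at *
    have hp := exp_pos (uCoord 1 f)
    refine mul_right_cancel₀ hp.ne' ?_
    linear_combination (1 / 2) * h4 + (1 / 2) * (1 - r) * h5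

theorem sCoord_uCoord (he : e = 0 ∨ e = 1) : sCoord e (uCoord e f) = exp f := by
  rcases he with rfl | rfl
  · simp [sCoord, uCoord]
  · have h := cCoord_sq (e := 1) (fun _ => uCoord_neg (f := f) rfl) (Or.inr rfl)
    rw [cCoord_uCoord (Or.inr rfl), sq_sqrt (by positivity), two_mul, exp_add] at h
    refine (sq_eq_sq₀ (sCoord_pos (fun _ => uCoord_neg rfl) (Or.inr rfl)).le
      (exp_pos f).le).1 ?_
    linarith

/-- The inverse of the coordinate change `uCoord`. -/
noncomputable def fCoord (e u : ℝ) : ℝ := log (sCoord e u)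

theorem uCoord_injective (he : e = 0 ∨ e = 1) : Function.Injective (uCoord e) := fun f g h => by
  rw [← exp_eq_exp, ← sCoord_uCoord he, h, sCoord_uCoord he]

theorem sCoord_injOn (he : e = 0 ∨ e = 1) : InjOn (sCoord e) {u | e = 1 → u < 0} := by
  intro u hu v hv h
  rcases he with rfl | rfl
  · simpa [sCoord] using h
  · simpa [sCoord] using h

theorem uCoord_fCoord (he : e = 0 ∨ e = 1) (hu : e = 1 → u < 0) : uCoord e (fCoord e u) = u := by
  refine sCoord_injOn he (fun h => uCoord_neg h) hu ?_
  rw [sCoord_uCoord he, fCoord, exp_log (sCoord_pos hu he)]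

theorem fCoord_uCoord (he : e = 0 ∨ e = 1) : fCoord e (uCoord e f) = f := by
  rw [fCoord, sCoord_uCoord he, log_exp]

theorem coshLength_eq {e₁ e₂ h f₁ f₂ : ℝ} (he₁ : e₁ = 0 ∨ e₁ = 1) (he₂ : e₂ = 0 ∨ e₂ = 1) :
    coshLength e₁ e₂ h f₁ f₂ = coshSide e₁ e₂ h (uCoord e₁ f₁) (uCoord e₂ f₂) := by
  have h0 : 0 ≤ 1 + e₁ * exp (2 * f₁) := by
    rcases he₁ with rfl | rfl <;> simp; positivity
  rw [coshSide, cCoord_uCoord he₁, cCoord_uCoord he₂, sCoord_uCoord he₁, sCoord_uCoord he₂,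
    coshLength, sqrt_mul h0, exp_add]

end CoordinateChange

/-! ### Curvature on the surface as a function of `u` -/

section Surface

variable {F : Type*} (T : Triangulation F) (ε : T.Vertex → ℝ) (η : T.Edge → ℝ)

/-- The restriction of a function on the vertices to the corners of a triangle. -/
def onFace {α : Type*} (u : T.Vertex → α) (σ : F) (k : Fin 3) : α := u (T.vertex (σ, k))

/-- The restriction of a function on the edges to the sides of a triangle. -/
def onSides {α : Type*} (h : T.Edge → α) (σ : F) (k : Fin 3) : α := h (T.edge (σ, k))

/-- The extended angle at a corner in terms of the coordinates `u`. -/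
noncomputable def uAngle (u : T.Vertex → ℝ) (x : F × Fin 3) : ℝ :=
  triAngle (T.onFace ε x.1) (T.onSides η x.1) (T.onFace u x.1) x.2

/-- The coordinates of a generalized discrete conformal factor. -/
noncomputable def toU (f : T.Vertex → ℝ) (i : T.Vertex) : ℝ := uCoord (ε i) (f i)

open Classical in
/-- The generalized combinatorial curvature in terms of the coordinates `u`. -/
noncomputable def uCurvature [Fintype F] (u : T.Vertex → ℝ) (i : T.Vertex) : ℝ :=
  2 * π - ∑ x : F × Fin 3, if T.vertex x = i then T.uAngle ε η u x else 0

variable {T ε η}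

/-- The weights take admissible values and satisfy the structure conditions. -/
structure IsWeight (T : Triangulation F) (ε : T.Vertex → ℝ) (η : T.Edge → ℝ) : Prop where
  weight : ∀ i, ε i = 0 ∨ ε i = 1
  edge : T.StructureCondition₁ ε η
  corner : T.StructureCondition₂ ε η

theorem IsWeight.isStructure (H : T.IsWeight ε η) (σ : F) :
    IsStructure (T.onFace ε σ) (T.onSides η σ) where
  weight _ := H.weight _
  edge k := H.edge (σ, k)
  corner k := H.corner σ k

theorem onFace_mem_admissible {u : T.Vertex → ℝ} (hu : u ∈ admissible ε) (σ : F) :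
    T.onFace u σ ∈ admissible (T.onFace ε σ) := fun _ hk => hu _ hk

theorem toU_mem_admissible (f : T.Vertex → ℝ) : T.toU ε f ∈ admissible ε :=
  fun _ hi => uCoord_neg hi

theorem IsWeight.edgeLength_eq (H : T.IsWeight ε η) (f : T.Vertex → ℝ) (σ : F) (k : Fin 3) :
    T.edgeLength ε η f (T.edge (σ, k)) =
      arcosh (triSide (T.onFace ε σ) (T.onSides η σ) (T.onFace (T.toU ε f) σ) k) :=
  congrArg arcosh (coshLength_eq (H.weight _) (H.weight _))

theorem IsWeight.one_lt_triSide (H : T.IsWeight ε η) {u : T.Vertex → ℝ} (hu : u ∈ admissible ε)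
    (σ : F) (k : Fin 3) : 1 < triSide (T.onFace ε σ) (T.onSides η σ) (T.onFace u σ) k :=
  (H.isStructure σ).one_lt_triSide (onFace_mem_admissible hu σ) k

theorem IsWeight.angle_eq (H : T.IsWeight ε η) (f : T.Vertex → ℝ) (x : F × Fin 3) :
    T.angle ε η f x = T.uAngle ε η (T.toU ε f) x := by
  have hone := H.one_lt_triSide (toU_mem_admissible f) x.1
  simp only [angle, H.edgeLength_eq]
  exact arccos_cornerCos_arcosh (hone _) (hone _) (hone _)

theorem IsWeight.edgeLength_pos (H : T.IsWeight ε η) (f : T.Vertex → ℝ) (σ : F) (k : Fin 3) :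
    0 < T.edgeLength ε η f (T.edge (σ, k)) := by
  rw [H.edgeLength_eq]
  exact arcosh_pos (H.one_lt_triSide (toU_mem_admissible f) σ k)

/-- The function `arccos` is constant outside `[-1, 1]`; so the cosine law gives the extended
angles, too. -/
theorem IsWeight.extAngle_eq_angle (H : T.IsWeight ε η) (f : T.Vertex → ℝ) (x : F × Fin 3) :
    T.extAngle ε η f x = T.angle ε η f x := by
  obtain ⟨σ, k⟩ := x
  by_cases hnd : T.FaceNondegenerate ε η f σ
  · simp [extAngle, hnd]
  simp only [extAngle, hnd, if_false, angle]
  simp only [FaceNondegenerate, not_and, not_forall, not_lt] at hnd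
  -- As all lengths are positive, some side `j` is at least the sum of the others. For `j = k` the
  -- angle at `k` is `π`; otherwise the side opposite to `k` is at most the difference of the other
  -- two, and the angle is `0`.
  obtain ⟨j, hj⟩ := hnd (H.edgeLength_pos f σ)
  have hpos : ∀ k, 0 < T.edgeLength ε η f (T.edge (σ, k)) := H.edgeLength_pos f σ
  clear hnd
  obtain ⟨l, hl⟩ : ∃ l : Fin 3 → ℝ, ∀ k, T.edgeLength ε η f (T.edge (σ, k)) = l k :=
    ⟨_, fun _ => rfl⟩
  simp only [hl] at hj hpos ⊢
  split_ifs with hk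
  · exact (arccos_eq_pi_of_add_le (hpos _) (hpos _) hk).symm
  · refine (arccos_eq_zero_of_le_abs_sub (hpos _) (hpos _) (hpos _) ?_).symm
    have h3 := (by decide : ∀ j k : Fin 3, j = k ∨ j = k + 1 ∨ j = k + 2) j k
    have k1 := (by decide : ∀ k : Fin 3, k + 1 + 1 = k + 2) k
    have k2 := (by decide : ∀ k : Fin 3, k + 1 + 2 = k) k
    have k3 := (by decide : ∀ k : Fin 3, k + 2 + 1 = k) k
    have k4 := (by decide : ∀ k : Fin 3, k + 2 + 2 = k + 1) k
    rcases h3 with rfl | rfl | rfl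
    · exact absurd hj hk
    · rw [k1, k2] at hj
      exact le_abs.2 (Or.inl (by linarith))
    · rw [k3, k4] at hj
      exact le_abs.2 (Or.inr (by linarith))

theorem IsWeight.triGram_pos (H : T.IsWeight ε η) {f : T.Vertex → ℝ} {σ : F}
    (hf : T.FaceNondegenerate ε η f σ) :
    0 < triGram (T.onFace ε σ) (T.onSides η σ) (T.onFace (T.toU ε f) σ) := by
  obtain ⟨hpos, htri⟩ := hf
  have h := gramDet_cosh_pos (hpos 0) (hpos 1) (hpos 2) (htri 0) (htri 1) (htri 2)
  have hone := H.one_lt_triSide (toU_mem_admissible f) σ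
  simp only [H.edgeLength_eq, cosh_arcosh (hone _).le] at h
  exact h

theorem IsWeight.toU_injective (H : T.IsWeight ε η) : Function.Injective (T.toU ε) :=
  fun _ _ h => funext fun i => uCoord_injective (H.weight i) (congrFun h i)

theorem uAngle_nonneg (u : T.Vertex → ℝ) (x : F × Fin 3) : 0 ≤ T.uAngle ε η u x := arccos_nonneg _

theorem uAngle_le_pi (u : T.Vertex → ℝ) (x : F × Fin 3) : T.uAngle ε η u x ≤ π := arccos_le_pi _

section Finite

variable [Fintype F]

theorem IsWeight.extCurvature_eq (H : T.IsWeight ε η) (f : T.Vertex → ℝ) (i : T.Vertex) :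
    T.extCurvature ε η f i = T.uCurvature ε η (T.toU ε f) i := by
  simp only [extCurvature, uCurvature, H.extAngle_eq_angle, H.angle_eq]

theorem IsWeight.curvature_eq (H : T.IsWeight ε η) (f : T.Vertex → ℝ) (i : T.Vertex) :
    T.curvature ε η f i = T.uCurvature ε η (T.toU ε f) i := by
  simp only [curvature, uCurvature, H.angle_eq]

/-- Each corner lies at exactly one vertex, so regrouping by triangles reduces statements on the
curvature to single triangles. -/
theorem sum_mul_uCurvature (u w : T.Vertex → ℝ) :
    ∑ i, w i * T.uCurvature ε η u i =
      2 * π * ∑ i, w i - ∑ σ, ∑ k, T.onFace w σ k *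
        triAngle (T.onFace ε σ) (T.onSides η σ) (T.onFace u σ) k := by
  classical
  simp only [uCurvature, mul_sub, Finset.sum_sub_distrib, Finset.mul_sum]
  congr 1
  · exact Finset.sum_congr rfl fun i _ => by ring
  · rw [Finset.sum_comm, Fintype.sum_prod_type]
    refine Finset.sum_congr rfl fun σ _ => Finset.sum_congr rfl fun k _ => ?_
    simp only [mul_ite, mul_zero]
    rw [Finset.sum_ite_eq]
    simp [onFace, uAngle]

theorem IsWeight.sum_mul_uCurvature_sub_nonneg (H : T.IsWeight ε η) {u v : T.Vertex → ℝ}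
    (hu : u ∈ admissible ε) (hv : v ∈ admissible ε) :
    0 ≤ ∑ i, (u i - v i) * (T.uCurvature ε η u i - T.uCurvature ε η v i) := by
  have h1 := sum_mul_uCurvature (ε := ε) (η := η) u (u - v)
  have h2 := sum_mul_uCurvature (ε := ε) (η := η) v (u - v)
  have h3 : ∑ σ, ∑ k, T.onFace (u - v) σ k *
      (triAngle (T.onFace ε σ) (T.onSides η σ) (T.onFace u σ) k -
        triAngle (T.onFace ε σ) (T.onSides η σ) (T.onFace v σ) k) ≤ 0 :=
    Finset.sum_nonpos fun σ _ => (H.isStructure σ).sum_mul_triAngle_sub_nonpos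
      (onFace_mem_admissible hv σ) (onFace_mem_admissible hu σ)
  simp only [mul_sub, Finset.sum_sub_distrib, Pi.sub_apply] at *
  linarith

theorem abs_uCurvature_le (u : T.Vertex → ℝ) (i : T.Vertex) :
    |T.uCurvature ε η u i| ≤ 2 * π + Fintype.card (F × Fin 3) * π := by
  classical
  have h1 : ∀ x ∈ Finset.univ, (if T.vertex x = i then T.uAngle ε η u x else 0) ≤ π := fun x _ => by
    split_ifs
    exacts [uAngle_le_pi u x, pi_pos.le]
  have h2 := Finset.sum_le_sum h1
  rw [Finset.sum_const, Finset.card_univ, nsmul_eq_mul] at h2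
  have h3 : 0 ≤ ∑ x, if T.vertex x = i then T.uAngle ε η u x else 0 :=
    Finset.sum_nonneg fun x _ => by
      split_ifs
      exacts [uAngle_nonneg u x, le_rfl]
  have h4 : T.uCurvature ε η u i =
    2 * π - ∑ x, if T.vertex x = i then T.uAngle ε η u x else 0 := by
    unfold uCurvature; congr! 2
  rw [h4, abs_le]
  constructor <;> linarith [pi_pos]

theorem IsWeight.differentiableAt_triSide (H : T.IsWeight ε η) {u : T.Vertex → ℝ}
    (hu : u ∈ admissible ε) (σ : F) (k : Fin 3) :
    DifferentiableAt ℝ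
      (fun v => triSide (T.onFace ε σ) (T.onSides η σ) (T.onFace v σ) k) u :=
  differentiableAt_coshSide (u₁ := fun v => T.onFace v σ (k + 1))
    (u₂ := fun v => T.onFace v σ (k + 2)) (H.weight _) (H.weight _) (hu _) (hu _)
    (differentiableAt_apply _ _) (differentiableAt_apply _ _)

theorem IsWeight.continuousAt_uCurvature (H : T.IsWeight ε η) {u : T.Vertex → ℝ}
    (hu : u ∈ admissible ε) (i : T.Vertex) :
    ContinuousAt (fun v => T.uCurvature ε η v i) u := by
  have hside := fun σ k => (H.differentiableAt_triSide hu σ k).continuousAt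
  refine ContinuousAt.sub continuousAt_const (tendsto_finsetSum _ fun x _ => ?_)
  split_ifs
  · exact continuousAt_arccos_cornerCos (hside _ _) (hside _ _) (hside _ _)
      (H.one_lt_triSide hu _ _) (H.one_lt_triSide hu _ _)
  · exact tendsto_const_nhds

theorem IsWeight.differentiableAt_uCurvature (H : T.IsWeight ε η) {u : T.Vertex → ℝ}
    (hu : u ∈ admissible ε)
    (hg : ∀ σ, 0 < triGram (T.onFace ε σ) (T.onSides η σ) (T.onFace u σ)) :
    DifferentiableAt ℝ (T.uCurvature ε η) u := by
  refine differentiableAt_pi.2 fun i => ?_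
  have hside := fun σ k => H.differentiableAt_triSide hu σ k
  refine DifferentiableAt.sub (differentiableAt_const _)
    (DifferentiableAt.fun_sum fun x _ => ?_)
  split_ifs
  · exact differentiableAt_arccos_cornerCos (hside _ _) (hside _ _) (hside _ _)
      (H.one_lt_triSide hu _ _) (H.one_lt_triSide hu _ _) ((hg x.1).trans_eq (triGram_eq _).symm)
  · exact differentiableAt_const _

/-- The form is a sum of nonnegative contributions of the triangles. Every vertex is a corner of
some triangle, so a nonzero `w` is nonzero on a triangle, whose contribution is positive. -/
theorem IsWeight.sum_mul_fderiv_pos (H : T.IsWeight ε η) {u w : T.Vertex → ℝ}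
    (hu : u ∈ admissible ε)
    (hg : ∀ σ, 0 < triGram (T.onFace ε σ) (T.onSides η σ) (T.onFace u σ)) (hw : w ≠ 0) :
    0 < ∑ i, w i * fderiv ℝ (T.uCurvature ε η) u w i := by
  have hex : ∀ σ, ∃ d ≤ 0, (T.onFace w σ ≠ 0 → d < 0) ∧
      HasDerivAt (fun s : ℝ => ∑ k, T.onFace w σ k * triAngle (T.onFace ε σ) (T.onSides η σ)
        (T.onFace (u + s • w) σ) k) d 0 := fun σ => by
    have hz : T.onFace u σ + (0 : ℝ) • T.onFace w σ = T.onFace u σ := by simp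
    exact (H.isStructure σ).exists_hasDerivAt (p := T.onFace u σ) (w := T.onFace w σ) (t := 0)
      (by rw [hz]; exact onFace_mem_admissible hu σ) (by rw [hz]; exact hg σ)
  choose d hd hd' hderiv using hex
  have h1 : HasDerivAt (fun s : ℝ => ∑ i, w i * T.uCurvature ε η (u + s • w) i)
      (0 - ∑ σ, d σ) 0 := by
    simp only [sum_mul_uCurvature]
    exact (hasDerivAt_const _ _).sub (HasDerivAt.fun_sum fun σ _ => hderiv σ)
  have h2 : HasDerivAt (fun s : ℝ => ∑ i, w i * T.uCurvature ε η (u + s • w) i)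
      (∑ i, w i * fderiv ℝ (T.uCurvature ε η) u w i) 0 := by
    have hline : HasDerivAt (fun s : ℝ => u + s • w) w 0 := by
      simpa using ((hasDerivAt_id (0 : ℝ)).smul_const w).const_add u
    have hk : HasFDerivAt (T.uCurvature ε η) (fderiv ℝ (T.uCurvature ε η) u)
        (u + (0 : ℝ) • w) := by
      simpa using (H.differentiableAt_uCurvature hu hg).hasFDerivAt
    have := hasDerivAt_pi.1 (hk.comp_hasDerivAt 0 hline)
    exact HasDerivAt.fun_sum fun i _ => (this i).const_mul (w i)
  rw [h2.unique h1, zero_sub, neg_pos]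
  obtain ⟨i, hi⟩ := Function.ne_iff.1 hw
  obtain ⟨⟨σ, k⟩, rfl⟩ := Quot.exists_rep i
  refine Finset.sum_neg' (fun σ _ => hd σ) ⟨σ, Finset.mem_univ _, hd' σ fun h => hi ?_⟩
  exact congrFun h k

/-- The flow decreases the coordinate of a vertex of weight one when it is close to zero. -/
theorem IsWeight.eventually_le_uCurvature (H : T.IsWeight ε η) {i : T.Vertex} (hi : ε i = 1)
    {κ : ℝ} (hκ : κ < 2 * π) :
    ∀ᶠ c in 𝓝[<] (0 : ℝ), ∀ u ∈ admissible ε, c ≤ u i → κ ≤ T.uCurvature ε η u i := by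
  classical
  set n : ℝ := (Fintype.card (F × Fin 3) : ℝ) with hn
  have hn0 : 0 ≤ n := by positivity
  -- At most `n` corners meet at `i`, so angles of at most `δ` sum to at most `2 * π - κ`.
  set δ := (2 * π - κ) / (n + 1) with hδ
  have hδ0 : 0 < δ := div_pos (by linarith) (by linarith)
  have hx : ∀ x : F × Fin 3, ∀ᶠ c in 𝓝[<] (0 : ℝ), T.vertex x = i →
      ∀ u ∈ admissible ε, c ≤ u i → T.uAngle ε η u x ≤ δ := fun x => by
    by_cases hxi : T.vertex x = i
    · subst hxi
      filter_upwards [(H.isStructure x.1).eventually_triAngle_le (k := x.2) hi hδ0] with c hc _ u hu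
        hcu
      exact hc _ (onFace_mem_admissible hu x.1) hcu
    · exact Eventually.of_forall fun c h => absurd h hxi
  filter_upwards [eventually_all.2 hx] with c hc u hu hcu
  have h1 : ∀ x ∈ Finset.univ, (if T.vertex x = i then T.uAngle ε η u x else 0) ≤ δ := fun x _ => by
    split_ifs with h
    exacts [hc x h u hu hcu, hδ0.le]
  have h2 := Finset.sum_le_sum h1
  rw [Finset.sum_const, Finset.card_univ, nsmul_eq_mul, ← hn] at h2
  have h3 : n * δ ≤ 2 * π - κ := by
    have : (n + 1) * δ = 2 * π - κ := by rw [hδ]; field_simp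
    linarith
  have h4 : T.uCurvature ε η u i =
    2 * π - ∑ x, if T.vertex x = i then T.uAngle ε η u x else 0 := by
    unfold uCurvature; congr! 2
  rw [h4]
  linarith

end Finite

end Surface

end Triangulation

end DiscreteConformal

namespace DiscreteConformal

open Set Filter Topology Real

namespace Triangulation

/-! ### The extended flow: existence, uniqueness, bounds and convergence -/

section Flow

variable {F : Type*} [Fintype F] {T : Triangulation F} {ε : T.Vertex → ℝ} {η : T.Edge → ℝ}
  {Kbar : T.Vertex → ℝ}

theorem IsWeight.isSolutionOn_iff (H : T.IsWeight ε η) {I : Set ℝ} {f : ℝ → T.Vertex → ℝ} :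
    T.IsSolutionOn ε η Kbar I f ↔ ∀ t ∈ I, ∀ i, HasDerivWithinAt (fun s => T.toU ε (f s) i)
      (Kbar i - T.uCurvature ε η (T.toU ε (f t)) i) I t := by
  simp only [IsSolutionOn, H.extCurvature_eq]
  rfl

/-- Levels that the coordinates of vertices of weight one cannot cross. -/
theorem IsWeight.exists_barrier (H : T.IsWeight ε η) (hK : ∀ i, Kbar i < 2 * π) :
    ∃ μ > 0, ∃ c < 0, ∀ u ∈ admissible ε, ∀ i, ε i = 1 → c ≤ u i →
      Kbar i - T.uCurvature ε η u i ≤ -μ := by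
  have h1 : ∀ i, ∀ᶠ μ in 𝓝[>] (0 : ℝ), Kbar i + μ < 2 * π := fun i => by
    filter_upwards [Ioo_mem_nhdsGT (sub_pos.2 (hK i))] with μ hμ
    linarith [hμ.2]
  obtain ⟨μ, hμK, hμ⟩ := ((eventually_all.2 h1).and self_mem_nhdsWithin).exists
  have h2 : ∀ i, ∀ᶠ c in 𝓝[<] (0 : ℝ), ε i = 1 → ∀ u ∈ admissible ε, c ≤ u i →
      Kbar i + μ ≤ T.uCurvature ε η u i := fun i => by
    by_cases hi : ε i = 1
    · filter_upwards [H.eventually_le_uCurvature hi (hμK i)] with c hc _ using hc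
    · exact Eventually.of_forall fun c h => absurd h hi
  obtain ⟨c, hc, hc0⟩ := ((eventually_all.2 h2).and self_mem_nhdsWithin).exists
  exact ⟨μ, hμ, c, hc0, fun u hu i hi hcu => by linarith [hc i hi u hu hcu]⟩

theorem IsWeight.exists_solution (H : T.IsWeight ε η) (hK : ∀ i, Kbar i < 2 * π)
    (f₀ : T.Vertex → ℝ) :
    ∃ f : ℝ → T.Vertex → ℝ, f 0 = f₀ ∧ T.IsSolutionOn ε η Kbar (Ici 0) f := by
  classical
  obtain ⟨μ, hμ, c, hc, hbar⟩ := H.exists_barrier hK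
  set u₀ := T.toU ε f₀ with hu₀
  -- The box contains the initial value and its walls are at or above the barrier level `c`.
  -- Truncating at `M` yields a field defined on the whole space with admissible arguments; its
  -- solution never leaves the box, where the truncation does nothing.
  set M : T.Vertex → ℝ := fun i => max (u₀ i) c with hM
  have hM0 : ∀ i, ε i = 1 → M i < 0 := fun i hi => max_lt (toU_mem_admissible f₀ i hi) hc
  set cap : (T.Vertex → ℝ) → T.Vertex → ℝ :=
    fun u i => if ε i = 1 then min (u i) (M i) else u i with hcap
  have hcapc : Continuous cap := by
    refine continuous_pi fun i => ?_
    by_cases hi : ε i = 1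
    · simp only [hcap, hi, if_true]; fun_prop
    · simp only [hcap, hi, if_false]; fun_prop
  have hcapadm : ∀ u, cap u ∈ admissible ε := fun u i hi => by
    simp only [hcap, hi, if_true]
    exact (min_le_right _ _).trans_lt (hM0 i hi)
  have hcapeq : ∀ u : T.Vertex → ℝ, (∀ i, ε i = 1 → u i ≤ M i) → cap u = u := fun u hu => by
    ext i
    by_cases hi : ε i = 1
    · simp [hcap, hi, hu i hi]
    · simp [hcap, hi]
  set G : (T.Vertex → ℝ) → T.Vertex → ℝ :=
    fun u i => Kbar i - T.uCurvature ε η (cap u) i with hG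
  have hGc : Continuous G := by
    refine continuous_pi fun i => continuous_iff_continuousAt.2 fun u => ?_
    exact continuousAt_const.sub (ContinuousAt.comp (f := cap)
      (H.continuousAt_uCurvature (hcapadm u) i) hcapc.continuousAt)
  have hGL : ∀ u, ‖G u‖ ≤ ∑ i, |Kbar i| + (2 * π + Fintype.card (F × Fin 3) * π) := fun u => by
    refine (pi_norm_le_iff_of_nonneg (by have := pi_pos; positivity)).2 fun i => ?_
    have h1 := Finset.single_le_sum (f := fun i => |Kbar i|) (fun i _ => abs_nonneg _)
      (Finset.mem_univ i)
    exact (abs_sub _ _).trans (add_le_add h1 (abs_uCurvature_le _ _))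
  obtain ⟨x, hx0, hxM, hx⟩ := exists_solution_of_dissipative (x₀ := u₀) (P := fun i => ε i = 1)
    (M := M) hGc hGL hμ
    (fun u i hi hu => by
      refine hbar _ (hcapadm u) i hi ?_
      simp only [hcap, hi, if_true, min_eq_right hu]
      exact le_max_right _ _)
    (fun u v hu hv => by
      have hua := hcapadm u
      have hva := hcapadm v
      simp only [hG]
      rw [hcapeq u hu] at hua ⊢
      rw [hcapeq v hv] at hva ⊢
      have := H.sum_mul_uCurvature_sub_nonneg hua hva
      rw [← neg_nonneg, ← Finset.sum_neg_distrib]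
      refine this.trans_eq (Finset.sum_congr rfl fun i _ => by ring))
    (fun i _ => le_max_left _ _)
  have hxa : ∀ t, 0 ≤ t → x t ∈ admissible ε := fun t ht i hi =>
    (hxM t ht i hi).trans_lt (hM0 i hi)
  have hxu : ∀ t, 0 ≤ t → T.toU ε (fun i => fCoord (ε i) (x t i)) = x t := fun t ht =>
    funext fun i => uCoord_fCoord (H.weight i) (hxa t ht i)
  refine ⟨fun t i => fCoord (ε i) (x t i), ?_, H.isSolutionOn_iff.2 fun t ht i => ?_⟩
  · ext i
    simp only [hx0]
    exact fCoord_uCoord (H.weight i)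
  · rw [hxu t ht]
    have h1 := hx t ht i
    simp only [hG] at h1
    rw [hcapeq _ (hxM t ht)] at h1
    exact h1.congr (fun s hs => congrFun (hxu s hs) i) (congrFun (hxu t ht) i)

/-- The contraction estimate with error `δ = 0`; monotonicity replaces a Lipschitz condition. -/
theorem IsWeight.solution_unique (H : T.IsWeight ε η) {τ : ℝ} {f g : ℝ → T.Vertex → ℝ}
    (hf : T.IsSolutionOn ε η Kbar (Ico 0 τ) f) (hg : T.IsSolutionOn ε η Kbar (Ico 0 τ) g)
    (h0 : g 0 = f 0) : ∀ t ∈ Ico 0 τ, g t = f t := by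
  rw [H.isSolutionOn_iff] at hf hg
  intro t ht
  have hsub : Icc 0 t ⊆ Ico 0 τ := fun s hs => ⟨hs.1, hs.2.trans_lt ht.2⟩
  have h1 := sum_sq_sub_le_of_dissipative (δ := 0) (y := fun s => T.toU ε (g s))
    (z := fun s => T.toU ε (f s)) hsub (fun s hs => hg s (hsub hs)) (fun s hs => hf s (hsub hs))
    (by simp only [h0]) (fun s _ => by
      have := H.sum_mul_uCurvature_sub_nonneg (toU_mem_admissible (ε := ε) (g s))
        (toU_mem_admissible (f s))
      rw [zero_mul, ← neg_nonneg, ← Finset.sum_neg_distrib]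
      exact this.trans_eq (Finset.sum_congr rfl fun i _ => by ring)) t ⟨ht.1, le_rfl⟩
  have h2 : ∑ i, (T.toU ε (g t) i - T.toU ε (f t) i) ^ 2 = 0 :=
    le_antisymm (by simpa using h1) (Finset.sum_nonneg fun i _ => sq_nonneg _)
  rw [Finset.sum_eq_zero_iff_of_nonneg fun i _ => sq_nonneg _] at h2
  exact H.toU_injective (funext fun i => sub_eq_zero.1 (pow_eq_zero_iff two_ne_zero |>.1
    (h2 i (Finset.mem_univ i))))

/-- At the larger of the initial coordinate and the barrier level the velocity is negative, so this
level is never crossed. -/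
theorem IsWeight.exists_upper_bound (H : T.IsWeight ε η) (hK : ∀ i, Kbar i < 2 * π)
    {f : ℝ → T.Vertex → ℝ} (hf : T.IsSolutionOn ε η Kbar (Ici 0) f) {i : T.Vertex}
    (hi : ε i = 1) : ∃ c < 0, ∀ t, 0 ≤ t → T.toU ε (f t) i ≤ c := by
  obtain ⟨μ, hμ, c, hc, hbar⟩ := H.exists_barrier hK
  rw [H.isSolutionOn_iff] at hf
  refine ⟨max (T.toU ε (f 0) i) c, max_lt (toU_mem_admissible (f 0) i hi) hc, fun t ht => ?_⟩
  refine le_of_deriv_neg_at_level (T := t)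
    (fun s hs => (hf s hs.1 i).mono Icc_subset_Ici_self) (le_max_left _ _) (fun s _ hs' => ?_) t
    ⟨ht, le_rfl⟩
  have := hbar _ (toU_mem_admissible (f s)) i hi ((le_max_right _ _).trans hs'.ge)
  linarith

/-- The squared distance `E` to the target is a Lyapunov function. Monotonicity confines the
solution to the ball of radius `√(E 0)`, and coercivity on this ball gives `E' ≤ -(2 * a) * E`. -/
theorem IsWeight.exponential_convergence (H : T.IsWeight ε η) {fbar : T.Vertex → ℝ}
    (hnd : T.Nondegenerate ε η fbar) (hcurv : ∀ i, T.curvature ε η fbar i = Kbar i)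
    {f : ℝ → T.Vertex → ℝ} (hf : T.IsSolutionOn ε η Kbar (Ici 0) f) :
    ∃ A a : ℝ, 0 < a ∧ ∀ t, 0 ≤ t → ∀ i,
      |T.toU ε (f t) i - T.toU ε fbar i| ≤ A * exp (-a * t) := by
  rw [H.isSolutionOn_iff] at hf
  simp only [H.curvature_eq] at hcurv
  have hp : T.toU ε fbar ∈ admissible ε := toU_mem_admissible fbar
  have hg := fun σ => H.triGram_pos (hnd σ)
  set p := T.toU ε fbar with hpdef
  set E : ℝ → ℝ := fun t => ∑ i, (T.toU ε (f t) i - p i) ^ 2 with hE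
  set E' : ℝ → ℝ := fun t => -2 * ∑ i, (T.toU ε (f t) i - p i) *
    (T.uCurvature ε η (T.toU ε (f t)) i - T.uCurvature ε η p i) with hE'
  have hderiv : ∀ t, 0 ≤ t → HasDerivWithinAt E (E' t) (Ici 0) t := fun t ht => by
    have := HasDerivWithinAt.fun_sum (u := Finset.univ) fun i _ =>
      (((hf t ht i).sub_const (p i)).fun_pow 2)
    refine this.congr_deriv ?_
    simp only [hE', Finset.mul_sum]
    refine Finset.sum_congr rfl fun i _ => ?_
    rw [hcurv i]
    ring
  have hsq : ∀ t i, (T.toU ε (f t) i - p i) ^ 2 ≤ E t := fun t i =>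
    Finset.single_le_sum (f := fun i => (T.toU ε (f t) i - p i) ^ 2) (fun i _ => sq_nonneg _)
      (Finset.mem_univ i)
  have hE0 : ∀ t, 0 ≤ E t := fun t => Finset.sum_nonneg fun i _ => sq_nonneg _
  have hmono : ∀ t, 0 ≤ t → E t ≤ E 0 := fun t ht => by
    have := le_mul_exp_of_deriv_le (b := 0) hderiv (fun s _ => by
      have := H.sum_mul_uCurvature_sub_nonneg (toU_mem_admissible (f s)) hp
      simp only [hE', neg_zero, zero_mul]
      linarith) ht
    simpa using this
  obtain ⟨a, ha, hcoer⟩ := exists_coercive (convex_admissible ε) hp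
    (fun u hu v hv => H.sum_mul_uCurvature_sub_nonneg hu hv)
    (H.differentiableAt_uCurvature hp hg).hasFDerivAt
    (fun w hw => H.sum_mul_fderiv_pos hp hg hw) (sqrt_nonneg (E 0))
  have hdecay : ∀ t, 0 ≤ t → E t ≤ E 0 * exp (-(2 * a) * t) := fun t ht =>
    le_mul_exp_of_deriv_le hderiv (fun s hs => by
      have hnorm : ‖T.toU ε (f s) - p‖ ≤ √(E 0) :=
        (pi_norm_le_iff_of_nonneg (sqrt_nonneg _)).2 fun i =>
          abs_le_sqrt ((hsq s i).trans (hmono s hs))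
      have := hcoer _ (toU_mem_admissible (f s)) hnorm
      simp only [hE', hE]
      linarith) ht
  refine ⟨√(E 0), a, ha, fun t ht i => ?_⟩
  refine abs_le_of_sq_le_sq ((hsq t i).trans ((hdecay t ht).trans_eq ?_)) (by positivity)
  rw [mul_pow, sq_sqrt (hE0 0), ← exp_nat_mul]
  congr 2
  push_cast
  ring

end Flow

end Triangulation

end DiscreteConformal

theorem theorem3p11 {F : Type*} [Fintype F] (T : DiscreteConformal.Triangulation F)
    (hT : T.Connected)
    (ε : T.Vertex → ℝ) (hε : ∀ i, ε i = 0 ∨ ε i = 1) (η : T.Edge → ℝ)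
    (h₁ : T.StructureCondition₁ ε η) (h₂ : T.StructureCondition₂ ε η)
    (Kbar : T.Vertex → ℝ) (hK : ∀ i, Kbar i < 2 * Real.pi)
    (hsum : 2 * Real.pi * (T.eulerChar : ℝ) < ∑ i, Kbar i) :
    -- the solution with initial value `f₀` exists for all time
    (∀ f₀ : T.Vertex → ℝ, ∃ f : ℝ → T.Vertex → ℝ, f 0 = f₀ ∧
      T.IsSolutionOn ε η Kbar (Set.Ici 0) f ∧
      ∀ τ : ℝ, 0 < τ → ∀ g : ℝ → T.Vertex → ℝ, g 0 = f₀ →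
        T.IsSolutionOn ε η Kbar (Set.Ico 0 τ) g → ∀ t ∈ Set.Ico 0 τ, g t = f t) ∧
    -- along it `u_i` stays bounded away from `0` at vertices with `ε_i = 1`
    (∀ f : ℝ → T.Vertex → ℝ, T.IsSolutionOn ε η Kbar (Set.Ici 0) f →
      ∀ i, ε i = 1 → ∃ c < 0, ∀ t : ℝ, 0 ≤ t →
        DiscreteConformal.Triangulation.uCoord (ε i) (f t i) ≤ c) ∧
    -- exponential convergence
    (∀ fbar : T.Vertex → ℝ, T.Nondegenerate ε η fbar → (∀ i, T.curvature ε η fbar i = Kbar i) →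
      ∀ f : ℝ → T.Vertex → ℝ, T.IsSolutionOn ε η Kbar (Set.Ici 0) f →
        ∃ A a : ℝ, 0 < a ∧ ∀ t : ℝ, 0 ≤ t → ∀ i,
          |DiscreteConformal.Triangulation.uCoord (ε i) (f t i) -
            DiscreteConformal.Triangulation.uCoord (ε i) (fbar i)| ≤ A * Real.exp (-a * t)) := by
  have H : T.IsWeight ε η := ⟨hε, h₁, h₂⟩
  refine ⟨fun f₀ => ?_, fun f hf i hi => H.exists_upper_bound hK hf hi,
    fun fbar hnd hcurv f hf => H.exponential_convergence hnd hcurv hf⟩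
  obtain ⟨f, hf0, hf⟩ := H.exists_solution hK f₀
  refine ⟨f, hf0, hf, fun τ _ g hg0 hg => H.solution_unique (fun t ht i => ?_) hg
    (hg0.trans hf0.symm)⟩
  exact (hf t ht.1 i).mono fun s hs => hs.1
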